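/- For a real matrix $A\in\mathbb R^{m\times n}$, the factor rank of $A$ is the smallest positive integer $k$ for which there are real matrices $B\in\mathbb R^{m\times k}$, $C\in\mathbb R^{k\times n}$ with $A_{ij}=\min_{1\le\tau\le k}(B_{i\tau}+C_{\tau j})$ for all $i,j$. Consider real random access machine programs: a program is a fixed finite text, independent of $m$, $n$ and $A$, built by sequencing, branching and loops. It works on registers holding natural numbers (used as indices), tables of natural numbers and arrays of real numbers, both addressed by pairs of registers. Its instructions are: setting an integer constant, copying and storing; addition and truncated subtraction of indices; the operations $+,-,\times,\div$ on reals (division by $0$ being not executable); and the comparisons $\le$ of two indices or of two reals. Each executed instruction and each evaluated comparison counts as one step; in particular, every arithmetic operation is counted. Theorem. There are such a program and a constant $K$ such that, for all $m,n\ge1$ and all $A\in\mathbb R^{m\times n}$, the program started on the input $(m,n,A)$ halts after at most $$K\left((m+n)^3\,mn\,\log(mn)+m^3n^3\right)$$ steps and correctly outputs whether the factor rank of $A$ is greater than $3$. In particular, this decision requires at most $O\left((m+n)^3mn\log(mn)+m^3n^3\right)$ arithmetic operations in the worst case. -/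

import Mathlib

/-! ## Tropical matrices and factor rank -/

/-- A real matrix regarded as a matrix over the min-plus semiring `ℝ ∪ {∞}`, in which tropical
addition is `min` and tropical multiplication is `+`. -/
def toTrop {m n : ℕ} (A : Matrix (Fin m) (Fin n) ℝ) :
    Matrix (Fin m) (Fin n) (Tropical (WithTop ℝ)) :=
  A.map fun x => Tropical.trop (x : WithTop ℝ)

/-- `A = B ⊗ C` for some real matrices `B` and `C` with inner dimension `k`. (For `k = 0` the
product has all entries `∞`, hence it is never a real matrix with at least one entry.) -/
def HasTropFactorization {m n : ℕ} (A : Matrix (Fin m) (Fin n) ℝ) (k : ℕ) : Prop :=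
  ∃ (B : Matrix (Fin m) (Fin k) ℝ) (C : Matrix (Fin k) (Fin n) ℝ),
    toTrop B * toTrop C = toTrop A

/-- The factor rank: the smallest inner dimension of a tropical factorization. -/
noncomputable def factorRank {m n : ℕ} (A : Matrix (Fin m) (Fin n) ℝ) : ℕ :=
  sInf {k | HasTropFactorization A k}

theorem toTrop_mul_apply {m n k : ℕ} (B : Matrix (Fin m) (Fin k) ℝ)
    (C : Matrix (Fin k) (Fin n) ℝ) (i : Fin m) (j : Fin n) :
    (toTrop B * toTrop C) i j
      = Tropical.trop (Finset.univ.inf fun τ => ((B i τ + C τ j : ℝ) : WithTop ℝ)) := by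
  apply Tropical.untrop_injective
  rw [Matrix.mul_apply, Finset.untrop_sum']
  rfl

/-- The set defining `factorRank` is never empty, so the infimum is a minimum. -/
theorem hasTropFactorization_rows {m n : ℕ} (A : Matrix (Fin m) (Fin n) ℝ) :
    HasTropFactorization A m := by
  classical
  obtain ⟨M, hM⟩ : ∃ M : ℝ, ∀ p : Fin m × Fin m × Fin n, A p.1 p.2.2 - A p.2.1 p.2.2 ≤ M := by
    obtain ⟨M, hM⟩ := (Set.finite_range
      fun p : Fin m × Fin m × Fin n => A p.1 p.2.2 - A p.2.1 p.2.2).bddAbove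
    exact ⟨M, fun p => hM ⟨p, rfl⟩⟩
  refine ⟨Matrix.of fun i τ => if i = τ then 0 else M, A, ?_⟩
  ext i j
  rw [toTrop_mul_apply]
  apply Tropical.untrop_injective
  change (Finset.univ : Finset (Fin m)).inf _ = ((A i j : ℝ) : WithTop ℝ)
  apply le_antisymm
  · refine (Finset.inf_le (Finset.mem_univ i)).trans ?_
    simp
  · refine Finset.le_inf fun τ _ => ?_
    have h := hM (i, τ, j)
    simp only at h
    refine WithTop.coe_le_coe.2 ?_
    rw [Matrix.of_apply]
    split_ifs with hi
    · rw [hi, zero_add]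
    · linarith

/-! ## A real random access machine

Programs are finite texts over finitely many index registers (holding natural numbers), tables of
natural numbers and arrays of real numbers; tables and arrays are addressed by the values of two
index registers. A program does not depend on the size of the input, its constants are integers,
and it has no rounding or any other way to turn a real into an index. -/

namespace RealRAM

/-- A reference to an entry of a table or an array: the number of the table or array, and the
numbers of the two index registers that hold the row and the column. -/
structure Cell where
  arr : ℕ
  row : ℕ
  col : ℕ

/-- The memory: index registers, tables of natural numbers, arrays of real numbers. -/
structure State where
  idx : ℕ → ℕ
  tab : ℕ → ℕ → ℕ → ℕ
  mem : ℕ → ℕ → ℕ → ℝ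

/-- The natural number that the reference `c` designates. -/
def State.getTab (s : State) (c : Cell) : ℕ := s.tab c.arr (s.idx c.row) (s.idx c.col)

/-- The real number that the reference `c` designates. -/
def State.getMem (s : State) (c : Cell) : ℝ := s.mem c.arr (s.idx c.row) (s.idx c.col)

def State.setIdx (s : State) (x v : ℕ) : State :=
  { s with idx := Function.update s.idx x v }

def State.setTab (s : State) (c : Cell) (v : ℕ) : State :=
  { s with tab := fun a i j =>
      if a = c.arr ∧ i = s.idx c.row ∧ j = s.idx c.col then v else s.tab a i j }

noncomputable def State.setMem (s : State) (c : Cell) (v : ℝ) : State :=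
  { s with mem := fun a i j =>
      if a = c.arr ∧ i = s.idx c.row ∧ j = s.idx c.col then v else s.mem a i j }

/-- Operations on indices: addition and truncated subtraction. -/
inductive IdxOp where
  | add
  | sub

def IdxOp.eval : IdxOp → ℕ → ℕ → ℕ
  | .add, x, y => x + y
  | .sub, x, y => x - y

/-- The arithmetic operations on reals. -/
inductive RealOp where
  | add
  | sub
  | mul
  | div

noncomputable def RealOp.eval : RealOp → ℝ → ℝ → ℝ
  | .add, x, y => x + y
  | .sub, x, y => x - y
  | .mul, x, y => x * y
  | .div, x, y => x / y

/-- Comparisons: of two index registers, or of two stored reals. -/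
inductive Test where
  | idxLE (x y : ℕ)
  | realLE (a b : Cell)

def Test.Holds : Test → State → Prop
  | .idxLE x y, s => s.idx x ≤ s.idx y
  | .realLE a b, s => s.getMem a ≤ s.getMem b

/-- Programs. -/
inductive Cmd where
  | skip
  | idxConst (x c : ℕ)
  | idxCopy (x y : ℕ)
  | idxOp (op : IdxOp) (x y z : ℕ)
  | loadIdx (x : ℕ) (c : Cell)
  | storeIdx (c : Cell) (x : ℕ)
  | realConst (d : Cell) (c : ℤ)
  | realCopy (d a : Cell)
  | realOp (op : RealOp) (d a b : Cell)
  | seq (P Q : Cmd)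
  | ite (b : Test) (P Q : Cmd)
  | while (b : Test) (P : Cmd)

/-- `Exec P s t s'`: started in memory `s`, the program `P` halts in memory `s'` after exactly `t`
elementary steps. Every executed instruction and every evaluated comparison is one step. A division
by zero cannot be executed: a program that attempts one does not halt properly. -/
inductive Exec : Cmd → State → ℕ → State → Prop
  | skip (s : State) : Exec .skip s 1 s
  | idxConst (s : State) (x c : ℕ) : Exec (.idxConst x c) s 1 (s.setIdx x c)
  | idxCopy (s : State) (x y : ℕ) : Exec (.idxCopy x y) s 1 (s.setIdx x (s.idx y))
  | idxOp (s : State) (op : IdxOp) (x y z : ℕ) :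
      Exec (.idxOp op x y z) s 1 (s.setIdx x (op.eval (s.idx y) (s.idx z)))
  | loadIdx (s : State) (x : ℕ) (c : Cell) : Exec (.loadIdx x c) s 1 (s.setIdx x (s.getTab c))
  | storeIdx (s : State) (c : Cell) (x : ℕ) : Exec (.storeIdx c x) s 1 (s.setTab c (s.idx x))
  | realConst (s : State) (d : Cell) (c : ℤ) : Exec (.realConst d c) s 1 (s.setMem d (c : ℝ))
  | realCopy (s : State) (d a : Cell) : Exec (.realCopy d a) s 1 (s.setMem d (s.getMem a))
  | realOp (s : State) (op : RealOp) (d a b : Cell) (h : op = .div → s.getMem b ≠ 0) :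
      Exec (.realOp op d a b) s 1 (s.setMem d (op.eval (s.getMem a) (s.getMem b)))
  | seq {P Q : Cmd} {s s' s'' : State} {t t' : ℕ} (hP : Exec P s t s') (hQ : Exec Q s' t' s'') :
      Exec (.seq P Q) s (t + t') s''
  | iteTrue {b : Test} {P Q : Cmd} {s s' : State} {t : ℕ} (hb : b.Holds s) (hP : Exec P s t s') :
      Exec (.ite b P Q) s (1 + t) s'
  | iteFalse {b : Test} {P Q : Cmd} {s s' : State} {t : ℕ} (hb : ¬ b.Holds s)
      (hQ : Exec Q s t s') : Exec (.ite b P Q) s (1 + t) s'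
  | whileTrue {b : Test} {P : Cmd} {s s' s'' : State} {t t' : ℕ} (hb : b.Holds s)
      (hP : Exec P s t s') (hW : Exec (.while b P) s' t' s'') :
      Exec (.while b P) s (1 + t + t') s''
  | whileFalse {b : Test} {P : Cmd} {s : State} (hb : ¬ b.Holds s) : Exec (.while b P) s 1 s

/-- The machine is deterministic: memory at halting and number of steps are determined by the
program and the initial memory. -/
theorem Exec.deterministic {P : Cmd} {s s₁ : State} {t₁ : ℕ} (h₁ : Exec P s t₁ s₁) :
    ∀ {t₂ : ℕ} {s₂ : State}, Exec P s t₂ s₂ → t₁ = t₂ ∧ s₁ = s₂ := by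
  induction h₁ with
  | seq _ _ ihP ihQ =>
    intro t₂ s₂ h
    cases h with
    | seq hP hQ =>
      obtain ⟨rfl, rfl⟩ := ihP hP
      obtain ⟨rfl, rfl⟩ := ihQ hQ
      exact ⟨rfl, rfl⟩
  | iteTrue hb _ ih =>
    intro t₂ s₂ h
    cases h with
    | iteTrue _ hP =>
      obtain ⟨rfl, rfl⟩ := ih hP
      exact ⟨rfl, rfl⟩
    | iteFalse hb' _ => exact absurd hb hb'
  | iteFalse hb _ ih =>
    intro t₂ s₂ h
    cases h with
    | iteTrue hb' _ => exact absurd hb' hb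
    | iteFalse _ hP =>
      obtain ⟨rfl, rfl⟩ := ih hP
      exact ⟨rfl, rfl⟩
  | whileTrue hb _ _ ihP ihW =>
    intro t₂ s₂ h
    cases h with
    | whileTrue _ hP hW =>
      obtain ⟨rfl, rfl⟩ := ihP hP
      obtain ⟨rfl, rfl⟩ := ihW hW
      exact ⟨rfl, rfl⟩
    | whileFalse hb' => exact absurd hb hb'
  | whileFalse hb =>
    intro t₂ s₂ h
    cases h with
    | whileTrue hb' _ _ => exact absurd hb' hb
    | whileFalse _ => exact ⟨rfl, rfl⟩
  | _ =>
    intro t₂ s₂ h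
    cases h
    exact ⟨rfl, rfl⟩

/-- The initial memory for the input `A`: index registers `0` and `1` hold the numbers of rows and
columns, array `0` holds the entries of `A`, and everything else is zero. -/
noncomputable def input {m n : ℕ} (A : Matrix (Fin m) (Fin n) ℝ) : State where
  idx := fun x => if x = 0 then m else if x = 1 then n else 0
  tab := fun _ _ _ => 0
  mem := fun a i j => if h : a = 0 ∧ i < m ∧ j < n then A ⟨i, h.2.1⟩ ⟨j, h.2.2⟩ else 0

end RealRAM

/-! Colour every entry by a term of a factorization that attains it. Entries `(i, j)` and `(k, l)`
attained by the same term satisfy `A i l + A k j ≤ A i j + A k l`, so incompatible entries get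
different colours. With three colours the converse holds (`factorRank_le_three_iff`): no colour
class of a proper colouring carries a closed walk of positive weight (`sum_step_nonpos`), so each
class has a potential, and this yields a term that bounds `A` from above and is exact on the class
(`exists_term`). The question becomes whether the graph of incompatible entries is 3-colourable.

If this graph has no triangle, two colours suffice (`colorable_of_no_tri`). Otherwise `exists_tri`
supplies a triangle of least weight in its 3×3 block; its colours may be taken to be 0, 1, 2. At
most one cyclic permutation of the block ties with it, and then the three entries of that
permutation can be coloured in only two ways, by rows or by columns, which gives two guesses
(`Tri.colorable_iff`). From a guess, colours are excluded by propagation: an entry that has lost all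
colours but `a` excludes `a` at its neighbours. The crux is that no further search is needed if no
entry loses all three colours. By `Frame.exists_excl` and `Frame.Doubled.exists_excl`, for adjacent
entries and any colour `a`, one of the two has lost a colour other than `a`; hence a fixed rule
depending only on the excluded colours completes the colouring (`Frame.colorable`).

The triangle is found by exhaustive search in `O(m³n³)` steps. There are at most `3mn` exclusions,
and a sweep over all `m²n²` pairs of entries either adds one or shows that none is missing, so
propagation also takes `O(m³n³)` steps. Correctness and running time of the program are proved
together, by a Hoare logic with step bounds (`Run`, `Marks`). -/

namespace TropRank

/-! ### Normalized triangles and excluded colours -/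

/-- The entries `(i, j)` and `(k, l)` cannot be attained by the same term of a factorization. -/
def Incompat {ι κ : Type*} (A : ι → κ → ℝ) (i : ι) (j : κ) (k : ι) (l : κ) : Prop :=
  A i j + A k l < A i l + A k j

theorem Incompat.symm {ι κ : Type*} {A : ι → κ → ℝ} {i k : ι} {j l : κ}
    (h : Incompat A i j k l) : Incompat A k l i j := by
  unfold Incompat at *
  linarith

/-- A normalized triangle of pairwise incompatible entries `(r a, c a)`, together with a relation
`X a i j` (the colour `a` is excluded at `(i, j)`) that is closed under propagation of colours and
never excludes all colours. -/
structure Frame {ι κ : Type*} (A : ι → κ → ℝ) (r : Fin 3 → ι) (c : Fin 3 → κ)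
    (X : Fin 3 → ι → κ → Prop) : Prop where
  diag : ∀ a, A (r a) (c a) = 0
  pair : ∀ a b, a ≠ b → 0 < A (r a) (c b) + A (r b) (c a)
  cyc : ∀ a b d, a ≠ b → b ≠ d → a ≠ d →
    0 ≤ A (r a) (c b) + A (r b) (c d) + A (r d) (c a)
  corner : ∀ a b, b ≠ a → X b (r a) (c a)
  closed : ∀ a i j k l, Incompat A i j k l → (∀ b, b ≠ a → X b k l) → X a i j
  consistent : ∀ i j, ¬ ∀ a, X a i j

theorem fin3_cases {a b d : Fin 3} (hab : a ≠ b) (hbd : b ≠ d) (had : a ≠ d) (x : Fin 3) :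
    x = a ∨ x = b ∨ x = d := by
  omega

theorem exists_third {a b : Fin 3} (hab : a ≠ b) : ∃ d : Fin 3, b ≠ d ∧ a ≠ d := by
  revert a b
  decide

namespace Frame

variable {ι κ : Type*} {A : ι → κ → ℝ} {r : Fin 3 → ι} {c : Fin 3 → κ} {X : Fin 3 → ι → κ → Prop}

theorem transpose (h : Frame A r c X) :
    Frame (fun j i => A i j) c r (fun a j i => X a i j) where
  diag := h.diag
  pair a b hab := by
    have := h.pair a b hab
    linarith
  cyc a b d hab hbd had := by
    have := h.cyc a d b had hbd.symm hab
    linarith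
  corner := h.corner
  closed a j i l k hI hX := by
    refine h.closed a i j k l ?_ hX
    unfold Incompat at *
    linarith
  consistent j i := h.consistent i j

/-- The entry of row `i` in column `c a` is excluded from the other colours by the triangle. -/
def RowDom (A : ι → κ → ℝ) (r : Fin 3 → ι) (c : Fin 3 → κ) (i : ι) (a : Fin 3) : Prop :=
  ∀ b, b ≠ a → A i (c a) < A i (c b) + A (r b) (c a)

/-- The entry of column `j` in row `r a` is excluded from the other colours by the triangle. -/
def ColDom (A : ι → κ → ℝ) (r : Fin 3 → ι) (c : Fin 3 → κ) (j : κ) (a : Fin 3) : Prop :=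
  ∀ b, b ≠ a → A (r a) j < A (r b) j + A (r a) (c b)

/-- The relation `X` determines the colours of sufficiently many entries of the row `i`. -/
def RowDet (A : ι → κ → ℝ) (r : Fin 3 → ι) (c : Fin 3 → κ) (X : Fin 3 → ι → κ → Prop)
    (i : ι) : Prop :=
  (∃ a, RowDom A r c i a) ∨
    ∀ a, (∀ b, b ≠ a → X b i (c a)) ∧ ∃ b, b ≠ a ∧ A i (c a) + A (r a) (c b) ≤ A i (c b)

/-- The relation `X` determines the colours of sufficiently many entries of the column `j`. -/
def ColDet (A : ι → κ → ℝ) (r : Fin 3 → ι) (c : Fin 3 → κ) (X : Fin 3 → ι → κ → Prop)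
    (j : κ) : Prop :=
  (∃ a, ColDom A r c j a) ∨
    ∀ a, (∀ b, b ≠ a → X b (r a) j) ∧ ∃ b, b ≠ a ∧ A (r a) j + A (r b) (c a) ≤ A (r b) j

/-- The hypothesis is incompatibility with the triangle entry `(r b, c b)`, which has value 0 and
colour `b`. -/
theorem excl (h : Frame A r c X) {i : ι} {j : κ} {b : Fin 3}
    (hlt : A i j < A i (c b) + A (r b) j) : X b i j := by
  refine h.closed b i j (r b) (c b) ?_ (fun d hd => h.corner b d hd)
  have := h.diag b
  unfold Incompat
  linarith

theorem rowDom_excl (h : Frame A r c X) {i : ι} {a : Fin 3} (hi : RowDom A r c i a) :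
    ∀ b, b ≠ a → X b i (c a) := fun b hb => h.excl (hi b hb)

theorem colDom_excl (h : Frame A r c X) {j : κ} {a : Fin 3} (hj : ColDom A r c j a) :
    ∀ b, b ≠ a → X b (r a) j := fun b hb => h.excl (by linarith [hj b hb])

theorem le_of_free (h : Frame A r c X) {i : ι} {j : κ} {b : Fin 3} (hb : ¬ X b i j) :
    A i (c b) + A (r b) j ≤ A i j := by
  by_contra hlt
  exact hb (h.excl (not_le.1 hlt))

theorem not_excl (h : Frame A r c X) {i : ι} {j : κ} {a : Fin 3}
    (hX : ∀ b, b ≠ a → X b i j) : ¬ X a i j := fun ha =>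
  h.consistent i j fun b => if hb : b = a then hb ▸ ha else hX b hb

theorem le_of_compat (h : Frame A r c X) {i k : ι} {j l : κ} {b : Fin 3} (hb : ¬ X b i j)
    (hX : ∀ d, d ≠ b → X d k l) : A i l + A k j ≤ A i j + A k l := by
  by_contra hlt
  exact hb (h.closed b i j k l (not_le.1 hlt) hX)

/-- Both `(i, c b)` and `(r b, j)` are forced to have colour `b`, hence are compatible; their
remaining corner `(r b, c b)` is 0. -/
theorem le_of_cross (h : Frame A r c X) {i : ι} {j : κ} {b : Fin 3}
    (hi : ∀ d, d ≠ b → X d i (c b)) (hj : ∀ d, d ≠ b → X d (r b) j) :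
    A i j ≤ A i (c b) + A (r b) j := by
  have := h.le_of_compat (h.not_excl hi) hj
  rw [h.diag] at this
  linarith

/-- Since `b` is free at both entries, `(i, j)` is compatible with `(k, c b)` and `(k, l)` with `(i,
c b)`. In the sum of the two inequalities the column `c b` cancels, which contradicts
incompatibility. -/
theorem not_common_row (h : Frame A r c X) {i k : ι} {j l : κ} {b : Fin 3}
    (hI : Incompat A i j k l) (hu : ¬ X b i j) (hw : ¬ X b k l)
    (hi : ∀ d, d ≠ b → X d i (c b)) (hk : ∀ d, d ≠ b → X d k (c b)) : False := by
  have h1 := h.le_of_compat hu hk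
  have h2 := h.le_of_compat hw hi
  unfold Incompat at hI
  linarith

theorem not_common_col (h : Frame A r c X) {i k : ι} {j l : κ} {b : Fin 3}
    (hI : Incompat A i j k l) (hu : ¬ X b i j) (hw : ¬ X b k l)
    (hj : ∀ d, d ≠ b → X d (r b) j) (hl : ∀ d, d ≠ b → X d (r b) l) : False := by
  have h1 := h.le_of_compat hu hl
  have h2 := h.le_of_compat hw hj
  unfold Incompat at hI
  linarith

/-- A row in which only the colour `a` is dominant: one of the other two does not beat `a`. -/
theorem only_row (h : Frame A r c X) {i : ι} {a b d : Fin 3} (hab : a ≠ b) (hbd : b ≠ d)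
    (had : a ≠ d) (hb : ¬ RowDom A r c i b) (hd : ¬ RowDom A r c i d) :
    A i (c a) + A (r a) (c b) ≤ A i (c b) ∨ A i (c a) + A (r a) (c d) ≤ A i (c d) := by
  by_contra! hcon
  obtain ⟨h1, h2⟩ := hcon
  have hp := h.pair b d hbd
  rcases lt_or_ge (A i (c b)) (A i (c d) + A (r d) (c b)) with h3 | h3
  · refine hb fun x hx => ?_
    rcases fin3_cases hab hbd had x with rfl | rfl | rfl
    exacts [h1, absurd rfl hx, h3]
  · refine hd fun x hx => ?_
    rcases fin3_cases hab hbd had x with rfl | rfl | rfl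
    exacts [h2, by linarith, absurd rfl hx]

/-- By `only_row` some `b ≠ a` does not beat `a` in row `i`. As `b` is free at `(i, j)`, dominance
of `a` in column `j` would push `A i j` strictly above the cross bound `A i (c a) + A (r a) j`. -/
theorem only_row_not_col (h : Frame A r c X) {i : ι} {j : κ} {a : Fin 3}
    (hi : RowDom A r c i a) (hi' : ∀ b, b ≠ a → ¬ RowDom A r c i b)
    (hu : ∀ b, b ≠ a → ¬ X b i j) : ¬ ColDom A r c j a := by
  intro hj
  have h1 := h.le_of_cross (h.rowDom_excl hi) (h.colDom_excl hj)
  obtain ⟨b, hab⟩ : ∃ b : Fin 3, a ≠ b := exists_ne a |>.imp fun _ h => h.symm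
  obtain ⟨d, hbd, had⟩ := exists_third hab
  rcases h.only_row hab hbd had (hi' b hab.symm) (hi' d had.symm) with h2 | h2
  · linarith [h.le_of_free (hu b hab.symm), hj b hab.symm]
  · linarith [h.le_of_free (hu d had.symm), hj d had.symm]

theorem only_row_not_special (h : Frame A r c X) {i : ι} {j : κ} {a : Fin 3}
    (hi : RowDom A r c i a) (hu : ∀ b, b ≠ a → ¬ X b i j) :
    ¬ ((∀ b, b ≠ a → X b (r a) j) ∧
      ∃ b, b ≠ a ∧ A (r a) j + A (r b) (c a) ≤ A (r b) j) := by
  rintro ⟨hj, b, hb, hle⟩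
  linarith [h.le_of_cross (h.rowDom_excl hi) hj, h.le_of_free (hu b hb), hi b hb]

/-- The entry `(r d, j)` loses `a` through `(i, c a)` and `b` through the triangle, so it has colour
`d`. It is incompatible with `(k, l)`, where `d` is free. -/
theorem false_of_row_cols (h : Frame A r c X) {i k : ι} {j l : κ} {a b d : Fin 3}
    (hab : a ≠ b) (hbd : b ≠ d) (had : a ≠ d) (hI : Incompat A i j k l)
    (hu : ∀ b, b ≠ a → ¬ X b i j) (hw : ∀ b, b ≠ a → ¬ X b k l)
    (hi : RowDom A r c i a) (hj : ColDom A r c j b) (hl : ColDom A r c l d) : False := by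
  have h1 := h.le_of_compat (hw b hab.symm) (h.colDom_excl hj)
  have h2 := h.le_of_compat (hu d had.symm) (h.colDom_excl hl)
  have h3 := h.le_of_free (hu d had.symm)
  have hI' : A i j + A k l < A i l + A k j := hI
  refine hw d had.symm (h.closed d k l (r d) j ?_ fun x hx => ?_)
  · unfold Incompat
    linarith
  · rcases fin3_cases hab hbd had x with rfl | rfl | rfl
    · refine h.closed _ (r d) j i (c x) ?_ (h.rowDom_excl hi)
      unfold Incompat
      linarith [hi d had.symm]
    · refine h.excl ?_
      linarith [hl x hbd]
    · exact absurd rfl hx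

/-- Otherwise `(k, c b)` loses every colour: `a` and `d` through the triangle, `b` through `(r b,
j)`. -/
theorem le_of_parallel (h : Frame A r c X) {i k : ι} {j l : κ} {a b d : Fin 3}
    (hab : a ≠ b) (hbd : b ≠ d) (had : a ≠ d) (hI : Incompat A i j k l)
    (hu : ∀ b, b ≠ a → ¬ X b i j) (hw : ∀ b, b ≠ a → ¬ X b k l)
    (hi : RowDom A r c i b) (hk : RowDom A r c k d)
    (hj : ColDom A r c j b) (hl : ColDom A r c l d) :
    A k (c a) + A (r a) (c b) ≤ A k (c b) := by
  have hI' : A i j + A k l < A i l + A k j := hI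
  have h1 := h.le_of_cross (h.rowDom_excl hi) (h.colDom_excl hj)
  have h2 := h.le_of_cross (h.rowDom_excl hk) (h.colDom_excl hl)
  have h3 := h.le_of_compat (hw b hab.symm) (h.rowDom_excl hi)
  have h4 := h.le_of_free (hw b hab.symm)
  have h5 := h.le_of_free (hu b hab.symm)
  by_contra! hlt
  refine h.consistent k (c b) fun x => ?_
  rcases fin3_cases hab hbd had x with rfl | rfl | rfl
  · exact h.excl hlt
  · refine h.closed x k (c x) (r x) j ?_ (h.colDom_excl hj)
    unfold Incompat
    linarith [h.diag x]
  · refine h.excl ?_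
    linarith [hl b hbd]

/-- Applying `le_of_parallel` to the matrix and to its transpose makes `a` dominant in row `i` and
in column `j` as well. The cross bound for `a` then contradicts freeness of `d` at `(i, j)`. -/
theorem false_of_parallel (h : Frame A r c X) {i k : ι} {j l : κ} {a b d : Fin 3}
    (hab : a ≠ b) (hbd : b ≠ d) (had : a ≠ d) (hI : Incompat A i j k l)
    (hu : ∀ b, b ≠ a → ¬ X b i j) (hw : ∀ b, b ≠ a → ¬ X b k l)
    (hi : RowDom A r c i b) (hk : RowDom A r c k d)
    (hj : ColDom A r c j b) (hl : ColDom A r c l d) : False := by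
  have h1 := h.le_of_parallel had hbd.symm hab hI.symm hw hu hk hi hl hj
  have hI' : Incompat (fun j i => A i j) l k j i := by
    unfold Incompat at *
    linarith
  have h2 : A (r a) j + A (r d) (c a) ≤ A (r d) j :=
    h.transpose.le_of_parallel had hbd.symm hab hI' hw hu hl hj hk hi
  have h3 := h.le_of_cross (h.rowDom_excl hi) (h.colDom_excl hj)
  have h4 := h.le_of_free (hu d had.symm)
  have hp := h.pair a d had
  have h5 : RowDom A r c i a := by
    intro x hx
    rcases fin3_cases hab hbd had x with rfl | rfl | rfl
    · exact absurd rfl hx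
    · linarith [hj a hab]
    · linarith
  have h6 : ColDom A r c j a := by
    intro x hx
    rcases fin3_cases hab hbd had x with rfl | rfl | rfl
    · exact absurd rfl hx
    · linarith [hi a hab]
    · linarith
  linarith [h.le_of_cross (h.rowDom_excl h5) (h.colDom_excl h6)]

/-- If both bounds failed, `a` would be dominant in row `i` and column `j`, and its cross bound
would contradict freeness of `b` at `(i, j)`. The two alternatives are paths from `b` to `d` in the
triangle, direct or through `a`. -/
theorem crossed_le (h : Frame A r c X) {i k : ι} {j l : κ} {a b d : Fin 3}
    (hab : a ≠ b) (hbd : b ≠ d) (had : a ≠ d) (hI : Incompat A i j k l)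
    (hu : ∀ b, b ≠ a → ¬ X b i j) (hw : ∀ b, b ≠ a → ¬ X b k l)
    (hk : RowDom A r c k d) (hl : ColDom A r c l b) :
    A i (c b) + A (r b) (c d) + A (r d) j ≤ A i j ∨
      A i (c b) + A (r b) (c a) + A (r a) (c d) + A (r d) j ≤ A i j := by
  have hI' : A i j + A k l < A i l + A k j := hI
  have fb := h.le_of_free (hu b hab.symm)
  have fd := h.le_of_free (hu d had.symm)
  have e1 := h.le_of_compat (hu d had.symm) (h.rowDom_excl hk)
  have e2 := h.le_of_compat (hu b hab.symm) (h.colDom_excl hl)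
  by_contra! hcon
  obtain ⟨hc1, hc2⟩ := hcon
  have h1 : A i (c a) + A (r a) (c d) ≤ A i (c d) := by
    by_contra! hlt
    refine hw d had.symm (h.closed d k l i (c d) ?_ fun x hx => ?_)
    · unfold Incompat
      linarith
    · rcases fin3_cases hab hbd had x with rfl | rfl | rfl
      · exact h.excl hlt
      · exact h.excl (by linarith)
      · exact absurd rfl hx
  have h2 : A (r a) j + A (r b) (c a) ≤ A (r b) j := by
    by_contra! hlt
    refine hw b hab.symm (h.closed b k l (r b) j ?_ fun x hx => ?_)
    · unfold Incompat
      linarith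
    · rcases fin3_cases hab hbd had x with rfl | rfl | rfl
      · exact h.excl (by linarith)
      · exact absurd rfl hx
      · exact h.excl (by linarith)
  have h5 : RowDom A r c i a := by
    intro x hx
    rcases fin3_cases hab hbd had x with rfl | rfl | rfl
    · exact absurd rfl hx
    · linarith
    · linarith [h.pair a x had]
  have h6 : ColDom A r c j a := by
    intro x hx
    rcases fin3_cases hab hbd had x with rfl | rfl | rfl
    · exact absurd rfl hx
    · linarith [h.pair a x hab]
    · linarith
  linarith [h.le_of_cross (h.rowDom_excl h5) (h.colDom_excl h6), h5 b hab.symm]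

/-- The bounds of `crossed_le` for the two entries give a path from `b` to `d` and one from `d` to
`b`. Together these form closed walks in the triangle, of nonnegative weight by `pair` and `cyc`, so
the cross bounds for `(i, l)` and `(k, j)` contradict incompatibility. -/
theorem false_of_crossed (h : Frame A r c X) {i k : ι} {j l : κ} {a b d : Fin 3}
    (hab : a ≠ b) (hbd : b ≠ d) (had : a ≠ d) (hI : Incompat A i j k l)
    (hu : ∀ b, b ≠ a → ¬ X b i j) (hw : ∀ b, b ≠ a → ¬ X b k l)
    (hi : RowDom A r c i b) (hk : RowDom A r c k d)
    (hj : ColDom A r c j d) (hl : ColDom A r c l b) : False := by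
  have hI' : A i j + A k l < A i l + A k j := hI
  have h1 := h.le_of_cross (h.rowDom_excl hi) (h.colDom_excl hl)
  have h2 := h.le_of_cross (h.rowDom_excl hk) (h.colDom_excl hj)
  have p1 := h.pair b d hbd
  have p2 := h.pair a b hab
  have p3 := h.pair a d had
  have q1 := h.cyc a b d hab hbd had
  have q2 := h.cyc a d b had hbd.symm hab
  rcases h.crossed_le hab hbd had hI hu hw hk hl with h3 | h3 <;>
  rcases h.crossed_le had hbd.symm hab hI.symm hw hu hi hj with h4 | h4 <;>
  linarith

/-- As `b` is not dominant in row `i` or column `l`, the obstruction must come from `d`, and `d` in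
turn is beaten by `a`. Adding these comparisons leaves the positive weights of the pairs `a, d` and
`b, d`. -/
theorem false_of_only_same (h : Frame A r c X) {i k : ι} {j l : κ} {a b d : Fin 3}
    (hab : a ≠ b) (hbd : b ≠ d) (had : a ≠ d) (hI : Incompat A i j k l)
    (hu : ∀ b, b ≠ a → ¬ X b i j) (hw : ∀ b, b ≠ a → ¬ X b k l)
    (hi : RowDom A r c i a) (hi' : ∀ b, b ≠ a → ¬ RowDom A r c i b)
    (hl : ColDom A r c l a) (hl' : ∀ b, b ≠ a → ¬ ColDom A r c l b)
    (hk : RowDom A r c k b) (hj : ColDom A r c j b) : False := by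
  have hI' : A i j + A k l < A i l + A k j := hI
  have h1 := h.le_of_cross (h.rowDom_excl hi) (h.colDom_excl hl)
  have h2 := h.le_of_cross (h.rowDom_excl hk) (h.colDom_excl hj)
  have fu := h.le_of_free (hu b hab.symm)
  have fw := h.le_of_free (hw b hab.symm)
  have a1 : A i (c b) < A i (c a) + A (r a) (c b) := by
    by_contra! hle
    linarith [hl b hab.symm]
  have a2 : A (r b) l < A (r a) l + A (r b) (c a) := by
    by_contra! hle
    linarith [hi b hab.symm]
  have b1 : A i (c d) + A (r d) (c b) ≤ A i (c b) := by
    by_contra! hlt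
    refine hi' b hab.symm fun x hx => ?_
    rcases fin3_cases hab hbd had x with rfl | rfl | rfl
    exacts [a1, absurd rfl hx, hlt]
  have b2 : A (r d) l + A (r b) (c d) ≤ A (r b) l := by
    by_contra! hlt
    refine hl' b hab.symm fun x hx => ?_
    rcases fin3_cases hab hbd had x with rfl | rfl | rfl
    exacts [a2, absurd rfl hx, hlt]
  have p := h.pair b d hbd
  have p' := h.pair a d had
  have c1 := h.only_row hab hbd had (hi' b hab.symm) (hi' d had.symm)
  have c2 : A (r a) l + A (r b) (c a) ≤ A (r b) l ∨ A (r a) l + A (r d) (c a) ≤ A (r d) l :=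
    h.transpose.only_row hab hbd had (hl' b hab.symm) (hl' d had.symm)
  rcases c1 with c1 | c1
  · linarith
  rcases c2 with c2 | c2
  · linarith
  linarith

theorem false_of_only_diff (h : Frame A r c X) {i k : ι} {j l : κ} {a b d : Fin 3}
    (hab : a ≠ b) (hbd : b ≠ d) (had : a ≠ d) (hI : Incompat A i j k l)
    (hu : ∀ b, b ≠ a → ¬ X b i j) (hw : ∀ b, b ≠ a → ¬ X b k l)
    (hi : RowDom A r c i a) (hi' : ∀ b, b ≠ a → ¬ RowDom A r c i b)
    (hl : ColDom A r c l a) (hk : RowDom A r c k d) (hj : ColDom A r c j b) : False := by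
  have hI' : A i j + A k l < A i l + A k j := hI
  have h1 := h.le_of_cross (h.rowDom_excl hi) (h.colDom_excl hl)
  have h2 := h.le_of_compat (hw b hab.symm) (h.colDom_excl hj)
  have h3 := h.le_of_compat (hu d had.symm) (h.rowDom_excl hk)
  have fu := h.le_of_free (hu b hab.symm)
  have fw := h.le_of_free (hw d had.symm)
  rcases h.only_row hab hbd had (hi' b hab.symm) (hi' d had.symm) with c1 | c1
  · linarith [hl b hab.symm]
  · linarith [hl d had.symm]

theorem false_of_only_row (h : Frame A r c X) {i k : ι} {j l : κ} {a : Fin 3}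
    (hI : Incompat A i j k l)
    (hu : ∀ b, b ≠ a → ¬ X b i j) (hw : ∀ b, b ≠ a → ¬ X b k l)
    (hk : RowDet A r c X k) (hj : ColDet A r c X j) (hl : ColDet A r c X l)
    (hi : RowDom A r c i a) (hi' : ∀ b, b ≠ a → ¬ RowDom A r c i b) : False := by
  have ha : ¬ ColDom A r c j a := h.only_row_not_col hi hi' hu
  rcases hj with ⟨b, hj⟩ | hj
  swap
  · exact h.only_row_not_special hi hu (hj a)
  have hab : a ≠ b := by
    rintro rfl
    exact ha hj
  obtain ⟨d, hbd, had⟩ := exists_third hab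
  by_cases hlb : ColDom A r c l b
  · exact h.not_common_col hI (hu b hab.symm) (hw b hab.symm) (h.colDom_excl hj)
      (h.colDom_excl hlb)
  by_cases hld : ColDom A r c l d
  · exact h.false_of_row_cols hab hbd had hI hu hw hi hj hld
  rcases hl with ⟨x, hx⟩ | hl
  swap
  · exact h.not_common_col hI (hu b hab.symm) (hw b hab.symm) (h.colDom_excl hj) (hl b).1
  have hla : ColDom A r c l a := by
    rcases fin3_cases hab hbd had x with rfl | rfl | rfl
    exacts [hx, absurd hx hlb, absurd hx hld]
  have hl' : ∀ y, y ≠ a → ¬ ColDom A r c l y := by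
    intro y hy
    rcases fin3_cases hab hbd had y with rfl | rfl | rfl
    exacts [absurd rfl hy, hlb, hld]
  have hka : ¬ RowDom A r c k a := h.transpose.only_row_not_col hla hl' hw
  rcases hk with ⟨y, hk⟩ | hk
  swap
  · exact h.transpose.only_row_not_special hla hw (hk a)
  rcases fin3_cases hab hbd had y with rfl | rfl | rfl
  · exact hka hk
  · exact h.false_of_only_same hab hbd had hI hu hw hi hi' hla hl' hk hj
  · exact h.false_of_only_diff hab hbd had hI hu hw hi hi' hla hk hj

theorem RowDet.cases {i : ι} (hi : RowDet A r c X i) (a : Fin 3) :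
    (RowDom A r c i a ∧ ∀ b, b ≠ a → ¬ RowDom A r c i b) ∨ (∃ b, b ≠ a ∧ RowDom A r c i b) ∨
      ∀ b, ∀ d, d ≠ b → X d i (c b) := by
  by_cases h1 : ∃ b, b ≠ a ∧ RowDom A r c i b
  · exact Or.inr (Or.inl h1)
  rcases hi with ⟨b, hb⟩ | hs
  · push Not at h1
    by_cases hba : b = a
    · exact Or.inl ⟨hba ▸ hb, h1⟩
    · exact absurd hb (h1 b hba)
  · exact Or.inr (Or.inr fun b => (hs b).1)

/-- All cases in which row `i` or row `k` lacks a dominant colour other than `a` are impossible, and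
a common dominant colour is ruled out by `not_common_row`. -/
theorem row_good (h : Frame A r c X) {i k : ι} {j l : κ} {a : Fin 3}
    (hI : Incompat A i j k l)
    (hu : ∀ b, b ≠ a → ¬ X b i j) (hw : ∀ b, b ≠ a → ¬ X b k l)
    (hi : RowDet A r c X i) (hk : RowDet A r c X k)
    (hj : ColDet A r c X j) (hl : ColDet A r c X l) :
    ∃ b d, a ≠ b ∧ b ≠ d ∧ a ≠ d ∧ RowDom A r c i b ∧ RowDom A r c k d := by
  rcases hi.cases a with ⟨h1, h2⟩ | ⟨b, hb, hib⟩ | hib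
  · exact (h.false_of_only_row hI hu hw hk hj hl h1 h2).elim
  · rcases hk.cases a with ⟨h1, h2⟩ | ⟨d, hd, hkd⟩ | hkd
    · exact (h.false_of_only_row hI.symm hw hu hi hl hj h1 h2).elim
    · refine ⟨b, d, hb.symm, ?_, hd.symm, hib, hkd⟩
      rintro rfl
      exact h.not_common_row hI (hu b hb) (hw b hb) (h.rowDom_excl hib) (h.rowDom_excl hkd)
    · exact (h.not_common_row hI (hu b hb) (hw b hb) (h.rowDom_excl hib) (hkd b)).elim
  · rcases hk.cases a with ⟨h1, h2⟩ | ⟨d, hd, hkd⟩ | hkd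
    · exact (h.false_of_only_row hI.symm hw hu hi hl hj h1 h2).elim
    · exact (h.not_common_row hI (hu d hd) (hw d hd) (hib d) (h.rowDom_excl hkd)).elim
    · obtain ⟨b, hb⟩ := exists_ne a
      exact (h.not_common_row hI (hu b hb) (hw b hb) (hib b) (hkd b)).elim

/-- In a counterexample, `row_good` for rows and for columns leaves two patterns of dominant
colours: `i, j` share one and `k, l` share the other, or `i, l` and `k, j` do. -/
theorem exists_excl (h : Frame A r c X) {i k : ι} {j l : κ} (a : Fin 3)
    (hI : Incompat A i j k l) (hi : RowDet A r c X i) (hk : RowDet A r c X k)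
    (hj : ColDet A r c X j) (hl : ColDet A r c X l) : ∃ b, b ≠ a ∧ (X b i j ∨ X b k l) := by
  by_contra! hcon
  have hu : ∀ b, b ≠ a → ¬ X b i j := fun b hb => (hcon b hb).1
  have hw : ∀ b, b ≠ a → ¬ X b k l := fun b hb => (hcon b hb).2
  obtain ⟨b, d, hab, hbd, had, hib, hkd⟩ := h.row_good hI hu hw hi hk hj hl
  have hI' : Incompat (fun j i => A i j) j i l k := by
    unfold Incompat at *
    linarith
  obtain ⟨x, y, hax, hxy, hay, hjx, hly⟩ := h.transpose.row_good hI' hu hw hj hl hi hk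
  rcases fin3_cases hab hbd had x with rfl | rfl | rfl
  · exact hax rfl
  · rcases fin3_cases hab hbd had y with rfl | rfl | rfl
    · exact hay rfl
    · exact hxy rfl
    · exact h.false_of_parallel hab hbd had hI hu hw hib hkd hjx hly
  · rcases fin3_cases hab hbd had y with rfl | rfl | rfl
    · exact hay rfl
    · exact h.false_of_crossed hab hbd had hI hu hw hib hkd hjx hly
    · exact hxy rfl

/-- The excluded colours of a frame can be completed to a proper colouring. -/
theorem colorable (h : Frame A r c X)
    (H : ∀ a i j k l, Incompat A i j k l → ∃ b, b ≠ a ∧ (X b i j ∨ X b k l)) :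
    ∃ f : ι → κ → Fin 3, ∀ i j k l, Incompat A i j k l → f i j ≠ f k l := by
  classical
  -- An entry with one colour left gets it; an entry that has lost only `b` gets `b + 1`; an entry
  -- that has lost nothing gets 0.
  have key : ∀ i j, ∃ p : Fin 3, (∀ b, b ≠ p → X b i j) ∨
      ((∃ b, ∀ d, d ≠ b → ¬ X d i j) ∧ ∀ b, X b i j → p = b + 1) := by
    intro i j
    by_cases h1 : ∃ p, ∀ b, b ≠ p → X b i j
    · obtain ⟨p, hp⟩ := h1
      exact ⟨p, Or.inl hp⟩
    by_cases h2 : ∃ b, X b i j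
    · obtain ⟨b, hb⟩ := h2
      have h3 : ∀ d, d ≠ b → ¬ X d i j := by
        intro d hd hX
        obtain ⟨e, hde, hbe⟩ := exists_third hd.symm
        refine h1 ⟨e, fun x hx => ?_⟩
        rcases fin3_cases hd.symm hde hbe x with rfl | rfl | rfl
        exacts [hb, hX, absurd rfl hx]
      refine ⟨b + 1, Or.inr ⟨⟨b, h3⟩, fun d hd => ?_⟩⟩
      by_contra hne
      exact h3 d (fun h4 => hne (by rw [h4])) hd
    · push Not at h2
      exact ⟨0, Or.inr ⟨⟨0, fun d _ => h2 d⟩, fun b hb => absurd hb (h2 b)⟩⟩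
  choose f hf using key
  refine ⟨f, fun i j k l hI heq => ?_⟩
  have aux : ∀ {i j k l}, Incompat A i j k l → f i j = f k l →
      (∀ b, b ≠ f k l → X b k l) → False := by
    intro i j k l hI heq hk
    have hX := h.closed (f k l) i j k l hI hk
    rcases hf i j with hi | ⟨-, hi⟩
    · rw [heq] at hi
      exact h.not_excl hi hX
    · have := hi _ hX
      rw [heq] at this
      revert this
      generalize f k l = p
      revert p
      decide
  rcases hf k l with hk | ⟨⟨b, hb⟩, hk⟩
  · exact aux hI heq hk
  rcases hf i j with hi | ⟨⟨d, hd⟩, hi⟩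
  · exact aux hI.symm heq.symm hi
  -- Both entries are undetermined here. `H` shows that each has lost exactly one colour and that
  -- these differ, so the shift by one gives different colours.
  obtain ⟨x, hxb, hx⟩ := H b i j k l hI
  have hx' : X x i j := hx.resolve_right (hb x hxb)
  obtain ⟨y, hyd, hy⟩ := H d i j k l hI
  have hy' : X y k l := hy.resolve_left (hd y hyd)
  have e1 := hi x hx'
  have e2 := hk y hy'
  have hxy : x = y := by
    rw [heq, e2] at e1
    exact (add_right_cancel e1).symm
  have : x = d := by
    by_contra hne
    exact hd x hne hx'
  exact hyd (hxy ▸ this)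

end Frame

end TropRank

namespace TropRank

/-! ### Potentials -/

/-- `Walk w a b x`: there is a nonempty walk of weight `x` from `a` to `b`. -/
inductive Walk {V : Type*} (w : V → V → ℝ) : V → V → ℝ → Prop
  | single (a b : V) : Walk w a b (w a b)
  | cons (a b d : V) (x : ℝ) (h : Walk w b d x) : Walk w a d (w a b + x)

theorem Walk.append {V : Type*} {w : V → V → ℝ} {a b d : V} {x y : ℝ} (h : Walk w a b x)
    (h' : Walk w b d y) : Walk w a d (x + y) := by
  induction h with
  | single a b => exact Walk.cons a b d y h'
  | cons a b e x _ ih =>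
    rw [add_assoc]
    exact Walk.cons a b d _ (ih h')

theorem Walk.exists_seq {V : Type*} {w : V → V → ℝ} {a b : V} {x : ℝ} (h : Walk w a b x) :
    ∃ (n : ℕ) (q : ℕ → V), q 0 = a ∧ q n = b ∧
      x = ∑ t ∈ Finset.range n, w (q t) (q (t + 1)) := by
  induction h with
  | single a b => exact ⟨1, fun t => if t = 0 then a else b, by simp⟩
  | cons a b d x _ ih =>
    obtain ⟨n, q, h0, hn, hx⟩ := ih
    refine ⟨n + 1, fun t => if t = 0 then a else q (t - 1), by simp, by simpa using hn, ?_⟩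
    rw [Finset.sum_range_succ', hx]
    simp [h0, add_comm]

/-- Without closed walks of positive weight there is a potential. -/
theorem exists_potential {V : Type*} [Finite V] (w : V → V → ℝ)
    (h : ∀ a x, Walk w a a x → x ≤ 0) : ∃ u : V → ℝ, ∀ a b, u a + w a b ≤ u b := by
  classical
  cases nonempty_fintype V
  -- Floyd–Warshall for heaviest walks with intermediate points in `F`. That each `d a b` is the
  -- weight of a walk is needed for `d z z ≤ 0`.
  have key : ∀ F : Finset V, ∃ d : V → V → ℝ, (∀ a b, w a b ≤ d a b) ∧
      (∀ z ∈ F, ∀ a b, d a z + d z b ≤ d a b) ∧ ∀ a b, Walk w a b (d a b) := by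
    intro F
    induction F using Finset.induction_on with
    | empty => exact ⟨w, fun _ _ => le_rfl, by simp, fun a b => Walk.single a b⟩
    | insert z F _ ih =>
      obtain ⟨d, h1, h2, h3⟩ := ih
      have hz : d z z ≤ 0 := h z _ (h3 z z)
      refine ⟨fun a b => max (d a b) (d a z + d z b), fun a b => (h1 a b).trans (le_max_left _ _),
        ?_, fun a b => ?_⟩
      · intro y hy a b
        have e1 : ∀ a, max (d a z) (d a z + d z z) = d a z := fun a => max_eq_left (by linarith)
        have e2 : ∀ b, max (d z b) (d z z + d z b) = d z b := fun b => max_eq_left (by linarith)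
        dsimp only
        rcases Finset.mem_insert.1 hy with rfl | hy
        · rw [e1, e2]
          exact le_max_right _ _
        · have f1 := h2 y hy a b
          have f2 := h2 y hy a z
          have f3 := h2 y hy z b
          have f4 := h2 y hy z z
          have g1 := le_max_left (d a b) (d a z + d z b)
          have g2 := le_max_right (d a b) (d a z + d z b)
          rcases max_choice (d a y) (d a z + d z y) with e | e <;> rw [e] <;>
          rcases max_choice (d y b) (d y z + d z b) with e' | e' <;> rw [e'] <;> linarith
      · dsimp only
        rcases max_choice (d a b) (d a z + d z b) with e | e <;> rw [e]
        exacts [h3 a b, (h3 a z).append (h3 z b)]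
  obtain ⟨d, h1, h2, -⟩ := key Finset.univ
  rcases isEmpty_or_nonempty V with hV | hV
  · exact ⟨fun _ => 0, fun a => (hV.false a).elim⟩
  refine ⟨fun b => Finset.univ.sup' Finset.univ_nonempty fun a => d a b, fun b e => ?_⟩
  obtain ⟨a, -, ha⟩ := Finset.exists_mem_eq_sup' Finset.univ_nonempty fun a => d a b
  dsimp only
  rw [ha]
  refine le_trans ?_ (Finset.le_sup' (fun a => d a e) (Finset.mem_univ a))
  linarith [h1 b e, h2 b (Finset.mem_univ b) a e]

/-! ### Closed walks in a colour class -/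

/-- The weight of a step between two entries. -/
def step {ι κ : Type*} (A : ι → κ → ℝ) (e e' : ι × κ) : ℝ := A e.1 e'.2 - A e.1 e.2

theorem sum_range_periodic (g : ℕ → ℝ) (n : ℕ) (hg : ∀ t, g (t + n) = g t) (x : ℕ) :
    ∑ t ∈ Finset.range n, g (x + t) = ∑ t ∈ Finset.range n, g t := by
  induction x with
  | zero => simp
  | succ x ih =>
    rw [← ih]
    have h1 := Finset.sum_range_succ (fun t => g (x + t)) n
    have h2 := Finset.sum_range_succ' (fun t => g (x + t)) n
    rw [h1] at h2
    simp only [hg, add_zero] at h2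
    have h3 : ∑ t ∈ Finset.range n, g (x + 1 + t) = ∑ t ∈ Finset.range n, g (x + (t + 1)) :=
      Finset.sum_congr rfl fun t _ => by rw [add_assoc, add_comm 1 t]
    linarith

theorem fin3_eq_of_ne {p q s t : Fin 3} (hp : p ≠ t) (hq : q ≠ t) (hs : s ≠ t) (h1 : p ≠ q)
    (h2 : q ≠ s) : p = s := by
  omega

/-- In a proper colouring with three colours, no colour class contains a closed walk of positive
weight. -/
theorem sum_step_nonpos {ι κ : Type*} {A : ι → κ → ℝ} {f : ι → κ → Fin 3}
    (hf : ∀ i j k l, Incompat A i j k l → f i j ≠ f k l) (a : Fin 3) (n : ℕ) :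
    ∀ q : ℕ → ι × κ, (∀ t, f (q t).1 (q t).2 = a) → q n = q 0 →
      ∑ t ∈ Finset.range n, step A (q t) (q (t + 1)) ≤ 0 := by
  -- A shortest closed walk of positive weight is considered. Its chords, the entries in the row of
  -- one point and the column of a later one, all avoid the colour `a`, so only two colours remain
  -- for them.
  induction n using Nat.strong_induction_on with
  | _ n ih =>
  intro q hq hn
  by_contra! hpos
  rcases Nat.lt_or_ge n 3 with hn3 | hn3
  · interval_cases n
    · simp at hpos
    · simp [step, hn] at hpos
    · refine hf (q 0).1 (q 0).2 (q 1).1 (q 1).2 ?_ ((hq 0).trans (hq 1).symm)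
      simp only [Finset.sum_range_succ, Finset.sum_range_zero, step, hn] at hpos
      unfold Incompat
      norm_num at hpos
      linarith
  set Ω := ∑ t ∈ Finset.range n, step A (q t) (q (t + 1)) with hΩ
  obtain ⟨s, hs⟩ : ∃ s : ℕ → ι × κ, s = fun t => q (t % n) := ⟨_, rfl⟩
  have hsa : ∀ t, f (s t).1 (s t).2 = a := fun t => by rw [hs]; exact hq _
  have hper : ∀ t, s (t + n) = s t := fun t => by simp [hs]
  have hΩs : ∀ x, ∑ t ∈ Finset.range n, step A (s (x + t)) (s (x + t + 1)) = Ω := by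
    intro x
    rw [sum_range_periodic (fun t => step A (s t) (s (t + 1))) n
      (fun t => by rw [hper, add_right_comm, hper])]
    refine Finset.sum_congr rfl fun t ht => ?_
    have ht := Finset.mem_range.1 ht
    have e1 : s t = q t := by simp [hs, Nat.mod_eq_of_lt ht]
    have e2 : s (t + 1) = q (t + 1) := by
      rcases Nat.lt_or_ge (t + 1) n with h | h
      · simp [hs, Nat.mod_eq_of_lt h]
      · obtain rfl : n = t + 1 := by omega
        simp [hs, hn]
    rw [e1, e2]
  obtain ⟨P, hP⟩ : ∃ P : ℕ → ℕ → ℝ,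
      P = fun x d => ∑ t ∈ Finset.range d, step A (s (x + t)) (s (x + t + 1)) := ⟨_, rfl⟩
  have hPn : ∀ x, P x n = Ω := fun x => by rw [hP]; exact hΩs x
  have hPadd : ∀ x d e, P x (d + e) = P x d + P (x + d) e := by
    intro x d e
    simp only [hP, Finset.sum_range_add, add_assoc]
  have hP1 : ∀ x, P x 1 = step A (s x) (s (x + 1)) := fun x => by simp [hP]
  have hPper : ∀ x d, P (x + n) d = P x d := by
    intro x d
    simp only [hP]
    refine Finset.sum_congr rfl fun t _ => ?_
    rw [add_right_comm x n t, hper, add_right_comm (x + t) n 1, hper]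
  -- chords are light
  have hchord : ∀ x d, 2 ≤ d → d + 1 ≤ n → step A (s x) (s (x + d)) ≤ P x d - Ω := by
    intro x d hd2 hdn
    obtain ⟨e, rfl⟩ : ∃ e, n = d + e := ⟨n - d, by omega⟩
    -- Replacing the arc of length `d` by the chord gives a shorter closed walk.
    have h1 := ih (e + 1) (by omega) (fun t => if t = 0 then s x else s (x + d + (t - 1)))
      (fun t => by split_ifs <;> exact hsa _)
      (by
        have := hper x
        simp only [Nat.add_eq_zero_iff, one_ne_zero, and_false, if_false, if_true,
          Nat.add_sub_cancel]
        rw [← this, add_assoc])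
    rw [Finset.sum_range_succ'] at h1
    simp only [Nat.add_eq_zero_iff, one_ne_zero, and_false, if_false, if_true,
      Nat.add_sub_cancel, zero_add, Nat.sub_self, add_zero] at h1
    have h2 := hPadd x d e
    rw [hPn] at h2
    have h3 : P (x + d) e = ∑ t ∈ Finset.range e,
        step A (s (x + d + t)) (s (x + d + (t + 1))) := by
      simp only [hP, add_assoc]
    linarith
  -- chords have another colour
  have hcol : ∀ x d, 2 ≤ d → d + 1 ≤ n → f (s x).1 (s (x + d)).2 ≠ a := by
    intro x d hd2 hdn hz
    have h0 := hchord x d hd2 hdn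
    obtain ⟨e, rfl⟩ : ∃ e, d = e + 2 := ⟨d - 2, by omega⟩
    -- If the chord had colour `a`, it could close up the arc by itself, giving a shorter closed
    -- walk of weight arc minus chord, which is at least `Ω > 0`.
    have h1 := ih (e + 2) (by omega)
      (fun t => if t = 0 ∨ t = e + 2 then ((s x).1, (s (x + (e + 2))).2) else s (x + t))
      (fun t => by
        split_ifs
        exacts [hz, hsa _]) (by simp)
    rw [Finset.sum_range_succ, Finset.sum_range_succ'] at h1
    have h2 : P x (e + 2) = step A (s x) (s (x + 1)) + P (x + 1) e +
        step A (s (x + (e + 1))) (s (x + (e + 2))) := by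
      rw [show e + 2 = 1 + e + 1 by ring, hPadd, hPadd, hP1, hP1]
      congr 3
      ring_nf
    have h3 : ∑ t ∈ Finset.range e, step A
          (if t + 1 = 0 ∨ t + 1 = e + 2 then ((s x).1, (s (x + (e + 2))).2) else s (x + (t + 1)))
          (if t + 1 + 1 = 0 ∨ t + 1 + 1 = e + 2 then ((s x).1, (s (x + (e + 2))).2)
            else s (x + (t + 1 + 1))) = P (x + 1) e := by
      simp only [hP]
      refine Finset.sum_congr rfl fun t ht => ?_
      have := Finset.mem_range.1 ht
      rw [if_neg (by omega), if_neg (by omega)]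
      congr 2 <;> ring
    rw [h3] at h1
    have e1 : ¬ (0 + 1 = 0 ∨ 0 + 1 = e + 2) := by omega
    have e2 : ¬ (e + 1 = 0 ∨ e + 1 = e + 2) := by omega
    simp only [true_or, if_true, if_neg e1, if_neg e2, or_true] at h1
    simp only [step, zero_add] at h0 h1 h2
    linarith
  -- Two consecutive arcs covering the walk plus one extra step: the two chords weigh at most that
  -- step minus `Ω`, which is incompatibility.
  have hadj1 : ∀ x d e, 2 ≤ d → d + 1 ≤ n → d + e = n + 1 →
      f (s x).1 (s (x + d)).2 ≠ f (s (x + d)).1 (s (x + d + e)).2 := by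
    intro x d e hd2 hdn hde
    refine hf _ _ _ _ ?_
    have h1 := hchord x d hd2 hdn
    have h2 := hchord (x + d) e (by omega) (by omega)
    have h3 := hPadd x d e
    rw [hde, hPadd, hPn, hPper, hP1] at h3
    have h4 : s (x + d + e) = s (x + 1) := by
      rw [add_assoc, hde, add_comm n 1, ← add_assoc, hper]
    rw [h4] at h2 ⊢
    simp only [step] at h1 h2 h3
    unfold Incompat
    linarith
  have hadj2 : ∀ x d e, 2 ≤ d → 2 ≤ e → d + e = n →
      f (s x).1 (s (x + d)).2 ≠ f (s (x + d)).1 (s (x + d + e)).2 := by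
    intro x d e hd2 hdn hde
    refine hf _ _ _ _ ?_
    have h1 := hchord x d hd2 (by omega)
    have h2 := hchord (x + d) e (by omega) (by omega)
    have h3 := hPadd x d e
    rw [hde, hPn] at h3
    have h4 : s (x + d + e) = s x := by rw [add_assoc, hde, hper]
    rw [h4] at h2 ⊢
    simp only [step] at h1 h2 h3
    unfold Incompat
    linarith
  -- The chord of length `n + 1 - d` from `x + d` is incompatible with the chords of length `d` from
  -- `x` and from `x + 1`. Only two colours are available, so those two agree: the colour depends
  -- only on the length.
  have hshift : ∀ d, 2 ≤ d → d + 1 ≤ n → ∀ x, f (s x).1 (s (x + d)).2 = f (s 0).1 (s (0 + d)).2 := by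
    intro d hd2 hdn x
    induction x with
    | zero => rfl
    | succ x ihx =>
      rw [← ihx]
      have h1 := hadj1 x d (n + 1 - d) hd2 hdn (by omega)
      have h2 := hadj1 (x + d) (n + 1 - d) d (by omega) (by omega) (by omega)
      have h3 : x + d + (n + 1 - d) = x + 1 + n := by omega
      rw [h3, hper, add_right_comm, hper] at h2
      rw [h3, hper] at h1
      refine (fin3_eq_of_ne (hcol x d hd2 hdn) ?_ (hcol (x + 1) d hd2 hdn) h1 h2).symm
      have := hcol (x + d) (n + 1 - d) (by omega) (by omega)
      rwa [h3, hper] at this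
  obtain ⟨γ, hγ⟩ : ∃ γ : ℕ → Fin 3, γ = fun d => f (s 0).1 (s (0 + d)).2 := ⟨_, rfl⟩
  have hγa : ∀ d, 2 ≤ d → d + 1 ≤ n → γ d ≠ a := fun d h1 h2 => by
    rw [hγ]; exact hcol 0 d h1 h2
  have hγ1 : ∀ d e, 2 ≤ d → d + 1 ≤ n → d + e = n + 1 → γ d ≠ γ e := by
    intro d e h1 h2 h3
    have := hadj1 0 d e h1 h2 h3
    rw [hshift e (by omega) (by omega) (0 + d)] at this
    rw [hγ]
    exact this
  have hγ2 : ∀ d e, 2 ≤ d → 2 ≤ e → d + e = n → γ d ≠ γ e := by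
    intro d e h1 h2 h3
    have := hadj2 0 d e h1 h2 h3
    rw [hshift e (by omega) (by omega) (0 + d)] at this
    rw [hγ]
    exact this
  -- Length `n - d` differs in colour both from `d` and from `d + 1`, so all lengths share one
  -- colour. This contradicts `hγ1` for the lengths 2 and `n - 1`.
  have hconst : ∀ t, t + 3 ≤ n → γ (t + 2) = γ 2 := by
    intro t
    induction t with
    | zero => simp
    | succ t iht =>
      intro ht
      rw [← iht (by omega)]
      exact fin3_eq_of_ne (hγa _ (by omega) (by omega)) (hγa (n - (t + 2)) (by omega) (by omega))
        (hγa _ (by omega) (by omega)) (hγ1 _ _ (by omega) (by omega) (by omega))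
        (hγ2 _ _ (by omega) (by omega) (by omega))
  refine hγ1 2 (n - 1) le_rfl hn3 (by omega) ?_
  rw [← hconst (n - 3) (by omega)]
  congr 1
  omega

/-! ### Factorizations and colourings -/

theorem hasTropFactorization_iff {m n k : ℕ} (A : Matrix (Fin m) (Fin n) ℝ) :
    HasTropFactorization A k ↔ ∃ (B : Matrix (Fin m) (Fin k) ℝ) (C : Matrix (Fin k) (Fin n) ℝ),
      ∀ i j, (∀ τ, A i j ≤ B i τ + C τ j) ∧ ∃ τ, A i j = B i τ + C τ j := by
  refine exists_congr fun B => exists_congr fun C => ?_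
  rw [← Matrix.ext_iff]
  refine forall_congr' fun i => forall_congr' fun j => ?_
  rw [toTrop_mul_apply]
  change Tropical.trop _ = Tropical.trop ((A i j : ℝ) : WithTop ℝ) ↔ _
  rw [Tropical.trop_injective.eq_iff]
  constructor
  · intro h
    have h1 : ∀ τ, A i j ≤ B i τ + C τ j := fun τ => by
      have := Finset.inf_le (f := fun τ => ((B i τ + C τ j : ℝ) : WithTop ℝ)) (Finset.mem_univ τ)
      rw [h] at this
      exact WithTop.coe_le_coe.1 this
    refine ⟨h1, ?_⟩
    rcases isEmpty_or_nonempty (Fin k) with hk | hk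
    · simp at h
    · obtain ⟨τ, -, hτ⟩ := Finset.exists_mem_eq_inf Finset.univ Finset.univ_nonempty
        fun τ => ((B i τ + C τ j : ℝ) : WithTop ℝ)
      rw [h] at hτ
      exact ⟨τ, WithTop.coe_injective hτ⟩
  · rintro ⟨h1, τ, hτ⟩
    refine le_antisymm ?_ (Finset.le_inf fun σ _ => WithTop.coe_le_coe.2 (h1 σ))
    exact (Finset.inf_le (Finset.mem_univ τ)).trans (by rw [hτ])

theorem exists_coloring_of_hasTropFactorization {m n k : ℕ} {A : Matrix (Fin m) (Fin n) ℝ}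
    (h : HasTropFactorization A k) :
    ∃ f : Fin m → Fin n → Fin k, ∀ i j k l, Incompat A i j k l → f i j ≠ f k l := by
  obtain ⟨B, C, h⟩ := (hasTropFactorization_iff A).1 h
  choose h1 f hf using h
  refine ⟨f, fun i j k l hI heq => ?_⟩
  have e1 := hf i j
  have e2 := hf k l
  rw [← heq] at e2
  unfold Incompat at hI
  linarith [h1 i l (f i j), h1 k j (f i j)]

theorem exists_term {ι κ : Type*} [Finite ι] [Finite κ] {A : ι → κ → ℝ} {f : ι → κ → Fin 3}
    (hf : ∀ i j k l, Incompat A i j k l → f i j ≠ f k l) (a : Fin 3) :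
    ∃ (b : ι → ℝ) (c : κ → ℝ), (∀ i j, A i j ≤ b i + c j) ∧
      ∀ i j, f i j = a → A i j = b i + c j := by
  classical
  cases nonempty_fintype ι
  cases nonempty_fintype κ
  rcases isEmpty_or_nonempty κ with hκ | hκ
  · exact ⟨fun _ => 0, fun _ => 0, fun _ j => (hκ.false j).elim, fun _ j => (hκ.false j).elim⟩
  let V := {e : ι × κ // f e.1 e.2 = a}
  obtain ⟨u, hu⟩ := exists_potential (V := V) (fun e e' => step A e.1 e'.1) (by
    intro e x hx
    obtain ⟨n, q, h0, hn, rfl⟩ := hx.exists_seq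
    exact sum_step_nonpos hf a n (fun t => (q t).1) (fun t => (q t).2) (by rw [h0, hn]))
  -- The potential of the class is extended to all columns by the least `c` that satisfies the
  -- constraints of the class.
  have hc : ∃ c : κ → ℝ, ∀ (e : V) (j : κ), u e + A e.1.1 j - A e.1.1 e.1.2 ≤ c j ∧
      c e.1.2 = u e := by
    rcases isEmpty_or_nonempty V with hV | hV
    · exact ⟨fun _ => 0, fun e => (hV.false e).elim⟩
    refine ⟨fun j => Finset.univ.sup' Finset.univ_nonempty
      fun e : V => u e + A e.1.1 j - A e.1.1 e.1.2, fun e j => ⟨?_, le_antisymm ?_ ?_⟩⟩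
    · exact Finset.le_sup' (fun e : V => u e + A e.1.1 j - A e.1.1 e.1.2) (Finset.mem_univ e)
    · refine Finset.sup'_le _ _ fun e' _ => ?_
      have := hu e' e
      simp only [step] at this
      linarith
    · refine le_trans ?_ (Finset.le_sup' (fun e' : V => u e' + A e'.1.1 e.1.2 - A e'.1.1 e'.1.2)
        (Finset.mem_univ e))
      linarith
  obtain ⟨c, hc⟩ := hc
  refine ⟨fun i => Finset.univ.sup' Finset.univ_nonempty fun j => A i j - c j, c,
    fun i j => ?_, fun i j hij => ?_⟩
  · have := Finset.le_sup' (fun j => A i j - c j) (Finset.mem_univ j)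
    linarith
  · have h1 : Finset.univ.sup' Finset.univ_nonempty (fun j => A i j - c j) = A i j - c j := by
      refine le_antisymm (Finset.sup'_le _ _ fun l _ => ?_)
        (Finset.le_sup' (fun j => A i j - c j) (Finset.mem_univ j))
      have h2 := (hc ⟨(i, j), hij⟩ l).1
      have h3 := (hc ⟨(i, j), hij⟩ j).2
      simp only at h2 h3
      linarith
    dsimp only
    rw [h1]
    ring

theorem hasTropFactorization_of_coloring {m n : ℕ} {A : Matrix (Fin m) (Fin n) ℝ}
    {f : Fin m → Fin n → Fin 3} (hf : ∀ i j k l, Incompat A i j k l → f i j ≠ f k l) :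
    HasTropFactorization A 3 := by
  choose b c h1 h2 using exists_term hf
  exact (hasTropFactorization_iff A).2 ⟨fun i τ => b τ i, c, fun i j =>
    ⟨fun τ => h1 τ i j, f i j, h2 _ i j rfl⟩⟩

/-- The factor rank is at most three if and only if the entries have a proper colouring with three
colours. -/
theorem factorRank_le_three_iff {m n : ℕ} (A : Matrix (Fin m) (Fin n) ℝ) :
    factorRank A ≤ 3 ↔
      ∃ f : Fin m → Fin n → Fin 3, ∀ i j k l, Incompat A i j k l → f i j ≠ f k l := by
  constructor
  · intro h
    obtain ⟨f, hf⟩ := exists_coloring_of_hasTropFactorization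
      (Nat.sInf_mem (s := {k | HasTropFactorization A k}) ⟨m, hasTropFactorization_rows A⟩)
    exact ⟨fun i j => Fin.castLE h (f i j), fun i j k l hI heq =>
      hf i j k l hI (Fin.castLE_injective h heq)⟩
  · rintro ⟨f, hf⟩
    exact Nat.sInf_le (hasTropFactorization_of_coloring hf)

end TropRank

/-! ### Ties: a second transversal of the triangle -/

namespace TropRank

namespace Frame

variable {ι κ : Type*} {A : ι → κ → ℝ} {r : Fin 3 → ι} {c : Fin 3 → κ} {X : Fin 3 → ι → κ → Prop}

theorem forall_ne {a b d : Fin 3} (hab : a ≠ b) (hbd : b ≠ d) (had : a ≠ d) {Q : Fin 3 → Prop}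
    (ha : Q a) (hb : Q b) : ∀ x, x ≠ d → Q x := by
  intro x hx
  rcases fin3_cases hab hbd had x with rfl | rfl | rfl
  exacts [ha, hb, absurd rfl hx]

/-- Without a dominant colour, each colour is beaten by another one, so the colours beat each other
cyclically. One orientation contradicts `hcyc`; in the other the cycle has weight at least 0, so
equality holds throughout. -/
theorem rowDom_or (h : Frame A r c X) {a b d : Fin 3} (hab : a ≠ b) (hbd : b ≠ d)
    (had : a ≠ d) (hcyc : 0 < A (r a) (c d) + A (r d) (c b) + A (r b) (c a)) (i : ι) :
    (∃ x, RowDom A r c i x) ∨ (A i (c b) = A i (c a) + A (r a) (c b) ∧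
      A i (c d) = A i (c b) + A (r b) (c d) ∧ A i (c a) = A i (c d) + A (r d) (c a)) := by
  by_contra! hcon
  obtain ⟨h1, h2⟩ := hcon
  have hdom : ∀ {a b d : Fin 3}, a ≠ b → b ≠ d → a ≠ d →
      A i (c a) < A i (c b) + A (r b) (c a) → A i (c d) + A (r d) (c a) ≤ A i (c a) := by
    intro a b d hab hbd had hlt
    by_contra! hlt'
    exact h1 a (forall_ne hbd had.symm hab.symm hlt hlt')
  have d1 := @hdom a b d hab hbd had
  have d2 := @hdom a d b had hbd.symm hab
  have d3 := @hdom b a d hab.symm had hbd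
  have d4 := @hdom b d a hbd had.symm hab.symm
  have d5 := @hdom d a b had.symm hab hbd.symm
  have d6 := @hdom d b a hbd.symm hab.symm had.symm
  have p1 := h.pair a b hab
  have p2 := h.pair b d hbd
  have p3 := h.pair a d had
  have q := h.cyc a b d hab hbd had
  rcases lt_or_ge (A i (c a)) (A i (c b) + A (r b) (c a)) with h3 | h3
  · have e1 := d1 h3
    have e2 := d5 (by linarith)
    have e3 := d4 (by linarith)
    have f1 : A i (c b) = A i (c a) + A (r a) (c b) := by linarith
    have f2 : A i (c d) = A i (c b) + A (r b) (c d) := by linarith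
    exact h2 f1 f2 (by linarith)
  · have e1 := d3 (by linarith)
    have e2 := d6 (by linarith)
    linarith

theorem colDom_or (h : Frame A r c X) {a b d : Fin 3} (hab : a ≠ b) (hbd : b ≠ d)
    (had : a ≠ d) (hcyc : 0 < A (r a) (c d) + A (r d) (c b) + A (r b) (c a)) (j : κ) :
    (∃ x, ColDom A r c j x) ∨ (A (r a) j = A (r a) (c b) + A (r b) j ∧
      A (r b) j = A (r b) (c d) + A (r d) j ∧ A (r d) j = A (r d) (c a) + A (r a) j) := by
  rcases h.transpose.rowDom_or had hbd.symm hab (by linarith) j with h1 | ⟨h1, h2, h3⟩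
  · exact Or.inl h1
  · exact Or.inr ⟨by linarith, by linarith, by linarith⟩

/-- The triangle together with the second transversal of its rows and columns, coloured by rows. -/
structure Doubled (A : ι → κ → ℝ) (r : Fin 3 → ι) (c : Fin 3 → κ)
    (X : Fin 3 → ι → κ → Prop) (a b d : Fin 3) : Prop where
  hab : a ≠ b
  hbd : b ≠ d
  had : a ≠ d
  zero : A (r a) (c b) + A (r b) (c d) + A (r d) (c a) = 0
  seed_a : ∀ x, x ≠ a → X x (r a) (c b)
  seed_b : ∀ x, x ≠ b → X x (r b) (c d)
  seed_d : ∀ x, x ≠ d → X x (r d) (c a)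

theorem Doubled.rotate {a b d : Fin 3} (D : Doubled A r c X a b d) : Doubled A r c X b d a where
  hab := D.hbd
  hbd := D.had.symm
  had := D.hab.symm
  zero := by linarith [D.zero]
  seed_a := D.seed_b
  seed_b := D.seed_d
  seed_d := D.seed_a

theorem Doubled.pos (h : Frame A r c X) {a b d : Fin 3} (D : Doubled A r c X a b d) :
    0 < A (r a) (c d) + A (r d) (c b) + A (r b) (c a) := by
  linarith [h.pair a b D.hab, h.pair b d D.hbd, h.pair a d D.had, D.zero]

/-- The colour `b` is lost through the seed `(r b, c d)` and `d` through the triangle. -/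
theorem Doubled.col_excl (h : Frame A r c X) {a b d : Fin 3} (D : Doubled A r c X a b d) {j : κ}
    (h1 : A (r a) j = A (r a) (c b) + A (r b) j) (h2 : A (r b) j = A (r b) (c d) + A (r d) j) :
    ∀ x, x ≠ a → X x (r a) j := by
  have hz := D.zero
  have hp := h.pair a d D.had
  refine forall_ne D.hbd D.had.symm D.hab.symm ?_ ?_
  · refine h.closed b (r a) j (r b) (c d) ?_ D.seed_b
    unfold Incompat
    linarith
  · exact h.excl (by linarith)

/-- Colouring the second transversal by rows determines even the columns without a dominant colour.
Flat rows are not determined in this way and need the case analysis of `false_of_flat`. -/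
theorem Doubled.colDet (h : Frame A r c X) {a b d : Fin 3} (D : Doubled A r c X a b d) (j : κ) :
    ColDet A r c X j := by
  rcases h.colDom_or D.hab D.hbd D.had (D.pos h) j with h1 | ⟨h1, h2, h3⟩
  · exact Or.inl h1
  · refine Or.inr fun x => ?_
    rcases fin3_cases D.hab D.hbd D.had x with rfl | rfl | rfl
    · exact ⟨D.col_excl h h1 h2, d, D.had.symm, by linarith⟩
    · exact ⟨D.rotate.col_excl h h2 h3, a, D.hab, by linarith⟩
    · exact ⟨D.rotate.rotate.col_excl h h3 h1, b, D.hbd, by linarith⟩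

/-- A row proportional to the rows of the triangle along the second transversal. -/
def Flat (A : ι → κ → ℝ) (r : Fin 3 → ι) (c : Fin 3 → κ) (a b d : Fin 3) (i : ι) : Prop :=
  A i (c b) = A i (c a) + A (r a) (c b) ∧
    A i (c d) = A i (c b) + A (r b) (c d) ∧ A i (c a) = A i (c d) + A (r d) (c a)

theorem Doubled.flat_excl (h : Frame A r c X) {a b d : Fin 3} (D : Doubled A r c X a b d) {i : ι}
    (hi : Flat A r c a b d i) : X b i (c a) ∧ X d i (c b) ∧ X a i (c d) := by
  obtain ⟨h1, h2, h3⟩ := hi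
  exact ⟨h.excl (by linarith [h.pair a b D.hab]), h.excl (by linarith [h.pair b d D.hbd]),
    h.excl (by linarith [h.pair a d D.had])⟩

section FlatRow

variable {a b d : Fin 3} {i k : ι} {j l : κ}

/-- The entries `(i, c a)` and `(i, c b)` are forced to the colours `d` and `b`, and `(k, c a)`
loses `a`. This contradicts each possible type of row `k`. -/
theorem false_of_flat_a (h : Frame A r c X) (D : Doubled A r c X a b d)
    (hI : Incompat A i j k l)
    (hu : ∀ b, b ≠ a → ¬ X b i j) (hw : ∀ b, b ≠ a → ¬ X b k l)
    (hi : Flat A r c a b d i) (hk : (∃ x, RowDom A r c k x) ∨ Flat A r c a b d k)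
    (hj : ColDom A r c j a) : False := by
  obtain ⟨xb, xd, xa⟩ := D.flat_excl h hi
  obtain ⟨i1, i2, i3⟩ := hi
  have hI' : A i j + A k l < A i l + A k j := hI
  have fb := h.le_of_free (hu b D.hab.symm)
  have fd := h.le_of_free (hu d D.had.symm)
  have hz := D.zero
  have Sd : ∀ x, x ≠ d → X x i (c a) := by
    refine forall_ne D.hab D.hbd D.had ?_ xb
    refine h.closed a i (c a) (r a) j ?_ (h.colDom_excl hj)
    unfold Incompat
    linarith [hj b D.hab.symm, h.diag a]
  have Sb : ∀ x, x ≠ b → X x i (c b) := by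
    refine forall_ne D.had D.hbd.symm D.hab ?_ xd
    refine h.closed a i (c b) (r a) j ?_ (h.colDom_excl hj)
    unfold Incompat
    linarith [hj b D.hab.symm, h.diag a]
  have e1 := h.le_of_compat (hw b D.hab.symm) Sb
  have e2 := h.le_of_compat (hw d D.had.symm) Sd
  have e3 : X a k (c a) := by
    refine h.closed a k (c a) (r a) j ?_ (h.colDom_excl hj)
    unfold Incompat
    linarith [hj b D.hab.symm, h.diag a]
  rcases hk with ⟨x, hx⟩ | hk
  · rcases fin3_cases D.hab D.hbd D.had x with rfl | rfl | rfl
    · exact h.not_excl (h.rowDom_excl hx) e3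
    · linarith [h.le_of_compat (hu x D.hab.symm) (h.rowDom_excl hx)]
    · linarith [h.le_of_compat (hu x D.had.symm) (h.rowDom_excl hx), hx b D.hbd]
  · have := h.le_of_compat (hu d D.had.symm)
      (forall_ne D.hab D.hbd D.had (Q := fun x => X x k (c a)) e3 (D.flat_excl h hk).1)
    linarith

/-- The row `k` is neither flat nor has a dominant colour other than `a`. -/
theorem only_of_cases (hk : (∃ x, RowDom A r c k x) ∨ Flat A r c a b d k)
    (h1 : ∀ x, x ≠ a → ¬ RowDom A r c k x) (h2 : ¬ Flat A r c a b d k) : RowDom A r c k a := by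
  rcases hk with ⟨x, hx⟩ | hk
  · by_cases hxa : x = a
    · exact hxa ▸ hx
    · exact absurd hx (h1 x hxa)
  · exact absurd hk h2

/-- The entry `(i, c d)` is forced to `d` and `(k, c d)` loses `b` but not `a`. Then `a` is the only
dominant colour of row `k`, which is excluded as for determined rows. -/
theorem false_of_flat_b (h : Frame A r c X) (D : Doubled A r c X a b d)
    (hI : Incompat A i j k l)
    (hu : ∀ b, b ≠ a → ¬ X b i j) (hw : ∀ b, b ≠ a → ¬ X b k l)
    (hi : Flat A r c a b d i) (hk : (∃ x, RowDom A r c k x) ∨ Flat A r c a b d k)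
    (hl : ColDet A r c X l) (hj : ColDom A r c j b) : False := by
  obtain ⟨xb, xd, xa⟩ := D.flat_excl h hi
  obtain ⟨i1, i2, i3⟩ := hi
  have hI' : A i j + A k l < A i l + A k j := hI
  have fd := h.le_of_free (hu d D.had.symm)
  have hz := D.zero
  have hjd := hj d D.hbd.symm
  have Sd : ∀ x, x ≠ d → X x i (c d) := by
    refine forall_ne D.hab D.hbd D.had xa ?_
    refine h.closed b i (c d) (r b) j ?_ (h.colDom_excl hj)
    unfold Incompat
    linarith
  have e1 := h.le_of_compat (hw d D.had.symm) Sd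
  have e2 : X b k (c d) := by
    refine h.closed b k (c d) (r b) j ?_ (h.colDom_excl hj)
    unfold Incompat
    linarith
  have e3 : ¬ X a k (c d) := by
    intro hX
    have := h.le_of_compat (hu d D.had.symm)
      (forall_ne D.hab D.hbd D.had (Q := fun x => X x k (c d)) hX e2)
    linarith
  have n1 : ∀ x, x ≠ a → ¬ RowDom A r c k x := by
    intro x hxa hx
    rcases fin3_cases D.hab D.hbd D.had x with rfl | rfl | rfl
    · exact hxa rfl
    · have f := h.le_of_compat (hu x D.hab.symm) (h.rowDom_excl hx)
      refine e3 (h.excl ?_)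
      linarith [hx a D.hab, h.pair a d D.had]
    · exact e3 (h.rowDom_excl hx a D.had)
  have ha := only_of_cases hk n1 fun hf => e3 (D.flat_excl h hf).2.2
  rcases hl with ⟨x, hx⟩ | hl
  · rcases fin3_cases D.hab D.hbd D.had x with rfl | rfl | rfl
    · exact h.only_row_not_col ha n1 hw hx
    · exact h.not_common_col hI (hu x D.hab.symm) (hw x D.hab.symm) (h.colDom_excl hj)
        (h.colDom_excl hx)
    · exact h.false_of_row_cols D.had D.hbd.symm D.hab hI.symm hw hu ha hx hj
  · exact h.only_row_not_special ha hw (hl a)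

theorem false_of_flat_d_lt (h : Frame A r c X) (D : Doubled A r c X a b d)
    (hI : Incompat A i j k l)
    (hu : ∀ b, b ≠ a → ¬ X b i j) (hw : ∀ b, b ≠ a → ¬ X b k l)
    (hi : Flat A r c a b d i) (hk : (∃ x, RowDom A r c k x) ∨ Flat A r c a b d k)
    (hl : ColDet A r c X l) (hj : ColDom A r c j d) (hlt : A i (c d) + A (r d) j < A i j) :
    False := by
  obtain ⟨xb, xd, xa⟩ := D.flat_excl h hi
  obtain ⟨i1, i2, i3⟩ := hi
  have hI' : A i j + A k l < A i l + A k j := hI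
  have hz := D.zero
  have Sb : ∀ x, x ≠ b → X x i (c d) := by
    refine forall_ne D.had D.hbd.symm D.hab xa ?_
    refine h.closed d i (c d) (r d) j ?_ (h.colDom_excl hj)
    unfold Incompat
    linarith [h.diag d]
  have e1 := h.le_of_compat (hw b D.hab.symm) Sb
  have e2 : X d k (c d) := by
    refine h.closed d k (c d) (r d) j ?_ (h.colDom_excl hj)
    unfold Incompat
    linarith [h.diag d]
  have e3 : ¬ X a k (c d) := by
    intro hX
    have := h.le_of_compat (hu b D.hab.symm)
      (forall_ne D.had D.hbd.symm D.hab (Q := fun x => X x k (c d)) hX e2)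
    linarith
  have n1 : ∀ x, x ≠ a → ¬ RowDom A r c k x := by
    intro x hxa hx
    rcases fin3_cases D.hab D.hbd D.had x with rfl | rfl | rfl
    · exact hxa rfl
    · have f := h.le_of_compat (hu x D.hab.symm) (h.rowDom_excl hx)
      refine e3 (h.excl ?_)
      linarith [hx a D.hab, h.pair a d D.had]
    · exact e3 (h.rowDom_excl hx a D.had)
  have ha := only_of_cases hk n1 fun hf => e3 (D.flat_excl h hf).2.2
  rcases hl with ⟨x, hx⟩ | hl
  · rcases fin3_cases D.hab D.hbd D.had x with rfl | rfl | rfl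
    · exact h.only_row_not_col ha n1 hw hx
    · exact h.false_of_row_cols D.hab D.hbd D.had hI.symm hw hu ha hx hj
    · exact h.not_common_col hI (hu x D.had.symm) (hw x D.had.symm) (h.colDom_excl hj)
        (h.colDom_excl hx)
  · exact h.only_row_not_special ha hw (hl a)

/-- With equality, column `j` forces nothing in row `i`, so column `l` is used: `d` is not dominant
there by `not_common_col`, which leaves `b` and `a`. -/
theorem false_of_flat_d_eq (h : Frame A r c X) (D : Doubled A r c X a b d)
    (hI : Incompat A i j k l)
    (hu : ∀ b, b ≠ a → ¬ X b i j) (hw : ∀ b, b ≠ a → ¬ X b k l)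
    (hi : Flat A r c a b d i) (hk : (∃ x, RowDom A r c k x) ∨ Flat A r c a b d k)
    (hl : ColDet A r c X l) (hj : ColDom A r c j d ∨ ∀ y x, x ≠ y → X x (r y) j)
    (heq : A i (c d) + A (r d) j = A i j) : False := by
  obtain ⟨xb, xd, xa⟩ := D.flat_excl h hi
  obtain ⟨i1, i2, i3⟩ := hi
  have hI' : A i j + A k l < A i l + A k j := hI
  have hz := D.zero
  have pab := h.pair a b D.hab
  have pbd := h.pair b d D.hbd
  have pad := h.pair a d D.had
  have Sj : ∀ x, x ≠ d → X x (r d) j := hj.elim h.colDom_excl fun hj => hj d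
  have e0 := h.le_of_compat (hw d D.had.symm) Sj
  have gb := h.le_of_free (hw b D.hab.symm)
  have gd := h.le_of_compat (hw d D.had.symm) D.seed_d
  have gb' := h.le_of_compat (hw b D.hab.symm) D.seed_b
  have nd : ¬ ColDom A r c l d := fun hld =>
    h.not_common_col hI (hu d D.had.symm) (hw d D.had.symm) Sj (h.colDom_excl hld)
  rcases hl with ⟨y, hy⟩ | hl
  swap
  · exact h.not_common_col hI (hu d D.had.symm) (hw d D.had.symm) Sj (hl d).1
  by_cases hlb : ColDom A r c l b
  · have b1 := hlb a D.hab
    have b2 := hlb d D.hbd.symm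
    have Sd : ∀ x, x ≠ d → X x i (c d) := by
      refine forall_ne D.hab D.hbd D.had xa ?_
      refine h.closed b i (c d) (r b) l ?_ (h.colDom_excl hlb)
      unfold Incompat
      linarith
    have e1 := h.le_of_compat (hw d D.had.symm) Sd
    have e2 : X d k (c d) := by
      refine h.closed d k (c d) (r d) j ?_ Sj
      unfold Incompat
      linarith [h.diag d]
    rcases hk with ⟨x, hx⟩ | hk
    · rcases fin3_cases D.hab D.hbd D.had x with rfl | rfl | rfl
      · rcases hj with hj | hj
        · exact h.false_of_row_cols D.hab D.hbd D.had hI.symm hw hu hx hlb hj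
        · exact h.not_common_col hI (hu b D.hab.symm) (hw b D.hab.symm) (hj b)
            (h.colDom_excl hlb)
      · linarith [h.le_of_cross (h.rowDom_excl hx) (h.colDom_excl hlb), hx a D.hab]
      · exact h.not_excl (h.rowDom_excl hx) e2
    · have Sk : ∀ x, x ≠ b → X x k (c d) :=
        forall_ne D.had D.hbd.symm D.hab (D.flat_excl h hk).2.2 e2
      have f1 := h.le_of_compat (h.not_excl Sk) (h.colDom_excl hlb)
      obtain ⟨k1, k2, k3⟩ := hk
      linarith
  have hla : ColDom A r c l a := by
    rcases fin3_cases D.hab D.hbd D.had y with rfl | rfl | rfl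
    exacts [hy, absurd hy hlb, absurd hy nd]
  have a1 := hla b D.hab.symm
  have a2 := hla d D.had.symm
  have hil : A i (c a) + A (r a) l < A i l := by
    by_contra! hle
    refine nd (forall_ne D.hab D.hbd D.had (Q := fun x => A (r d) l < A (r x) l + A (r d) (c x))
      ?_ ?_) <;> linarith
  have Sd : ∀ x, x ≠ d → X x i (c a) := by
    refine forall_ne D.hab D.hbd D.had ?_ xb
    refine h.closed a i (c a) (r a) l ?_ (h.colDom_excl hla)
    unfold Incompat
    linarith [h.diag a]
  have Sb : ∀ x, x ≠ b → X x i (c b) := by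
    refine forall_ne D.had D.hbd.symm D.hab ?_ xd
    refine h.closed a i (c b) (r a) l ?_ (h.colDom_excl hla)
    unfold Incompat
    linarith
  have e1 := h.le_of_compat (hw b D.hab.symm) Sb
  have e2 := h.le_of_compat (hw d D.had.symm) Sd
  rcases hk with ⟨x, hx⟩ | hk
  · rcases fin3_cases D.hab D.hbd D.had x with rfl | rfl | rfl
    · linarith [h.le_of_cross (h.rowDom_excl hx) (h.colDom_excl hla), hx d D.had.symm]
    · linarith [h.le_of_compat (hu x D.hab.symm) (h.rowDom_excl hx)]
    · linarith [h.le_of_compat (hu x D.had.symm) (h.rowDom_excl hx), hx b D.hbd]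
  · have hk' := D.flat_excl h hk
    obtain ⟨k1, k2, k3⟩ := hk
    have Sk : ∀ x, x ≠ a → X x k (c a) := by
      refine forall_ne D.hbd D.had.symm D.hab.symm hk'.1 ?_
      refine h.closed d k (c a) (r d) j ?_ Sj
      unfold Incompat
      linarith
    linarith [h.le_of_cross Sk (h.colDom_excl hla)]

theorem false_of_flat (h : Frame A r c X) (D : Doubled A r c X a b d)
    (hI : Incompat A i j k l)
    (hu : ∀ b, b ≠ a → ¬ X b i j) (hw : ∀ b, b ≠ a → ¬ X b k l)
    (hi : Flat A r c a b d i) (hk : (∃ x, RowDom A r c k x) ∨ Flat A r c a b d k) : False := by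
  have hl := D.colDet h l
  have fd := h.le_of_free (hu d D.had.symm)
  rcases h.colDom_or D.hab D.hbd D.had (D.pos h) j with ⟨x, hx⟩ | ⟨h1, h2, h3⟩
  · rcases fin3_cases D.hab D.hbd D.had x with rfl | rfl | rfl
    · exact h.false_of_flat_a D hI hu hw hi hk hx
    · exact h.false_of_flat_b D hI hu hw hi hk hl hx
    · rcases fd.lt_or_eq with hlt | heq
      · exact h.false_of_flat_d_lt D hI hu hw hi hk hl hx hlt
      · exact h.false_of_flat_d_eq D hI hu hw hi hk hl (Or.inl hx) heq
  · have hS : ∀ y x, x ≠ y → X x (r y) j := by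
      intro y
      rcases fin3_cases D.hab D.hbd D.had y with rfl | rfl | rfl
      exacts [D.col_excl h h1 h2, D.rotate.col_excl h h2 h3, D.rotate.rotate.col_excl h h3 h1]
    rcases fd.lt_or_eq with hlt | heq
    · obtain ⟨i1, i2, i3⟩ := hi
      -- The three entries `(r y, j)` have all three colours, and `(i, c a)` is incompatible with
      -- each.
      refine h.consistent i (c a) fun y => h.closed y i (c a) (r y) j ?_ (hS y)
      unfold Incompat
      have pab := h.pair a b D.hab
      have pad := h.pair a d D.had
      have hz := D.zero
      have := h.diag a
      rcases fin3_cases D.hab D.hbd D.had y with rfl | rfl | rfl <;> linarith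
    · exact h.false_of_flat_d_eq D hI hu hw hi hk hl (Or.inr hS) heq

theorem Doubled.exists_excl (h : Frame A r c X) (D : Doubled A r c X a b d)
    (hI : Incompat A i j k l) : ∃ b, b ≠ a ∧ (X b i j ∨ X b k l) := by
  have hi := h.rowDom_or D.hab D.hbd D.had (D.pos h) i
  have hk := h.rowDom_or D.hab D.hbd D.had (D.pos h) k
  rcases hi with hi' | hi'
  · rcases hk with hk' | hk'
    · exact h.exists_excl a hI (Or.inl hi') (Or.inl hk') (D.colDet h j) (D.colDet h l)
    · by_contra! hcon
      exact h.false_of_flat D hI.symm (fun b hb => (hcon b hb).2) (fun b hb => (hcon b hb).1)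
        hk' (Or.inl hi')
  · by_contra! hcon
    exact h.false_of_flat D hI (fun b hb => (hcon b hb).1) (fun b hb => (hcon b hb).2) hi'
      hk

end FlatRow

end Frame

end TropRank

/-! ### Triangles, seeds and propagation -/

namespace TropRank

variable {ι κ : Type*} {A : ι → κ → ℝ} {r : Fin 3 → ι} {c : Fin 3 → κ}

/-- Three rows and columns whose diagonal entries are pairwise incompatible and minimize the
tropical determinant, possibly together with one cyclic permutation. -/
structure Tri (A : ι → κ → ℝ) (r : Fin 3 → ι) (c : Fin 3 → κ) : Prop where
  h01 : Incompat A (r 0) (c 0) (r 1) (c 1)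
  h02 : Incompat A (r 0) (c 0) (r 2) (c 2)
  h12 : Incompat A (r 1) (c 1) (r 2) (c 2)
  lt : A (r 0) (c 0) + A (r 1) (c 1) + A (r 2) (c 2) <
    A (r 0) (c 2) + A (r 1) (c 0) + A (r 2) (c 1)
  le : A (r 0) (c 0) + A (r 1) (c 1) + A (r 2) (c 2) ≤
    A (r 0) (c 1) + A (r 1) (c 2) + A (r 2) (c 0)

theorem Tri.incompat (h : Tri A r c) {a b : Fin 3} (hab : a ≠ b) :
    Incompat A (r a) (c a) (r b) (c b) := by
  have h1 := h.h01.symm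
  have h2 := h.h02.symm
  have h3 := h.h12.symm
  fin_cases a <;> fin_cases b <;> simp_all [h.h01, h.h02, h.h12]

/-- The colour `a` is prescribed at the entry `(i, j)`: at the triangle, and, if a cyclic
permutation ties with it, at the entries of that permutation, by rows or by columns. -/
def Seed (A : ι → κ → ℝ) (r : Fin 3 → ι) (c : Fin 3 → κ) (g : Bool) (a : Fin 3) (i : ι)
    (j : κ) : Prop :=
  (i = r a ∧ j = c a) ∨
    (A (r 0) (c 1) + A (r 1) (c 2) + A (r 2) (c 0) ≤
      A (r 0) (c 0) + A (r 1) (c 1) + A (r 2) (c 2) ∧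
      if g then i = r a ∧ j = c (a + 1) else i = r (a + 2) ∧ j = c a)

/-- The colours excluded by propagation from the prescribed colours. -/
inductive Excl (A : ι → κ → ℝ) (S : Fin 3 → ι → κ → Prop) : Fin 3 → ι → κ → Prop
  | seed {a b : Fin 3} {i : ι} {j : κ} (h : S a i j) (hb : b ≠ a) : Excl A S b i j
  | step {a : Fin 3} {i k : ι} {j l : κ} (hI : Incompat A i j k l)
      (h : ∀ b, b ≠ a → Excl A S b k l) : Excl A S a i j

theorem Excl.ne {S : Fin 3 → ι → κ → Prop} {f : ι → κ → Fin 3}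
    (hf : ∀ i j k l, Incompat A i j k l → f i j ≠ f k l) (hS : ∀ a i j, S a i j → f i j = a)
    {a : Fin 3} {i : ι} {j : κ} (h : Excl A S a i j) : f i j ≠ a := by
  induction h with
  | seed h hb =>
    rw [hS _ _ _ h]
    exact hb.symm
  | @step a i k j l hI _ ih =>
    have : f k l = a := by
      by_contra hne
      exact ih _ hne rfl
    rw [← this]
    exact hf _ _ _ _ hI

theorem incompat_sub_iff (v : κ → ℝ) {i k : ι} {j l : κ} :
    Incompat (fun i j => A i j - v j) i j k l ↔ Incompat A i j k l := by
  unfold Incompat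
  constructor <;> intro h <;> linarith

/-- Subtracting a function of the column preserves incompatibility, and the columns of the triangle
are distinct, so its entries can be normalized to 0. -/
theorem Tri.exists_frame (h : Tri A r c) {X : Fin 3 → ι → κ → Prop}
    (hT : ∀ a b, b ≠ a → X b (r a) (c a))
    (hcl : ∀ a i j k l, Incompat A i j k l → (∀ b, b ≠ a → X b k l) → X a i j)
    (hcon : ∀ i j, ¬ ∀ a, X a i j) :
    ∃ v : κ → ℝ, Frame (fun i j => A i j - v j) r c X ∧ ∀ a, v (c a) = A (r a) (c a) := by
  have hc : Function.Injective c := by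
    intro a b hab
    by_contra hne
    have := h.incompat hne
    rw [hab] at this
    exact lt_irrefl _ this
  have hv : ∀ a, Function.extend c (fun a => A (r a) (c a)) 0 (c a) = A (r a) (c a) :=
    fun a => hc.extend_apply _ _ a
  refine ⟨Function.extend c (fun a => A (r a) (c a)) 0, ?_, hv⟩
  constructor
  · intro a
    simp only [hv, sub_self]
  · intro a b hab
    simp only [hv]
    have := h.incompat hab
    unfold Incompat at this
    linarith
  · intro a b d hab hbd had
    simp only [hv]
    have h1 := h.lt
    have h2 := h.le
    fin_cases a <;> fin_cases b <;> fin_cases d <;> simp at hab hbd had ⊢ <;> linarith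
  · exact hT
  · intro a i j k l hI
    exact hcl a i j k l ((incompat_sub_iff _).1 hI)
  · exact hcon

theorem Tri.colorable_of_excl (h : Tri A r c) (g : Bool)
    (hcon : ∀ i j, ¬ ∀ a, Excl A (Seed A r c g) a i j) :
    ∃ f : ι → κ → Fin 3, ∀ i j k l, Incompat A i j k l → f i j ≠ f k l := by
  obtain ⟨v, F, hv⟩ := h.exists_frame (X := Excl A (Seed A r c g))
    (fun a b hb => Excl.seed (Or.inl ⟨rfl, rfl⟩) hb) (fun a i j k l => Excl.step) hcon
  have h1 := h.lt
  suffices H : ∀ a i j k l, Incompat A i j k l →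
      ∃ b, b ≠ a ∧ (Excl A (Seed A r c g) b i j ∨ Excl A (Seed A r c g) b k l) by
    obtain ⟨f, hf⟩ := F.colorable fun a i j k l hI => H a i j k l ((incompat_sub_iff v).1 hI)
    exact ⟨f, fun i j k l hI => hf i j k l ((incompat_sub_iff v).2 hI)⟩
  intro a i j k l hI
  rw [← incompat_sub_iff v] at hI
  rcases h.le.lt_or_eq with h2 | h2
  · have hpos : 0 < (fun i j => A i j - v j) (r 0) (c 1) + (fun i j => A i j - v j) (r 1) (c 2) +
        (fun i j => A i j - v j) (r 2) (c 0) := by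
      simp only [hv]
      linarith
    have hrow : ∀ i, Frame.RowDet (fun i j => A i j - v j) r c (Excl A (Seed A r c g)) i := by
      intro i
      -- A flat row would give the other cycle weight 0, against `Tri.lt`.
      refine Or.inl ((F.rowDom_or (a := 0) (b := 2) (d := 1) (by decide) (by decide) (by decide)
        hpos i).resolve_right ?_)
      rintro ⟨e1, e2, e3⟩
      simp only [hv] at e1 e2 e3
      linarith
    have hcol : ∀ j, Frame.ColDet (fun i j => A i j - v j) r c (Excl A (Seed A r c g)) j := by
      intro j
      refine Or.inl ((F.colDom_or (a := 0) (b := 2) (d := 1) (by decide) (by decide) (by decide)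
        hpos j).resolve_right ?_)
      rintro ⟨e1, e2, e3⟩
      simp only [hv] at e1 e2 e3
      linarith
    exact F.exists_excl a hI (hrow i) (hrow k) (hcol j) (hcol l)
  · cases g with
    | true =>
      have hs : ∀ a x, x ≠ a → Excl A (Seed A r c true) x (r a) (c (a + 1)) := fun a x hx =>
        Excl.seed (Or.inr ⟨h2.ge, by simp⟩) hx
      have D : Frame.Doubled (fun i j => A i j - v j) r c (Excl A (Seed A r c true)) 0 1 2 :=
        ⟨by decide, by decide, by decide, by simp only [hv]; linarith, hs 0, hs 1, hs 2⟩
      fin_cases a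
      exacts [D.exists_excl F hI, D.rotate.exists_excl F hI, D.rotate.rotate.exists_excl F hI]
    | false =>
      have hs : ∀ a x, x ≠ a → Excl A (Seed A r c false) x (r (a + 2)) (c a) := fun a x hx =>
        Excl.seed (Or.inr ⟨h2.ge, by simp⟩) hx
      -- Colouring by columns is colouring by rows in the transpose, where the second transversal
      -- runs through 0, 2, 1.
      have D : Frame.Doubled (fun j i => A i j - v j) c r
          (fun a j i => Excl A (Seed A r c false) a i j) 0 2 1 :=
        ⟨by decide, by decide, by decide, by simp only [hv]; linarith, hs 0, hs 2, hs 1⟩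
      have hI' : Incompat (fun j i => A i j - v j) j i l k := by
        unfold Incompat at *
        linarith
      have e0 := D.exists_excl F.transpose hI'
      have e1 := D.rotate.rotate.exists_excl F.transpose hI'
      have e2 := D.rotate.exists_excl F.transpose hI'
      fin_cases a
      exacts [e0, e1, e2]

/-- Propagation from a triangle decides whether there is a proper colouring. -/
theorem Tri.colorable_iff (h : Tri A r c) :
    (∃ f : ι → κ → Fin 3, ∀ i j k l, Incompat A i j k l → f i j ≠ f k l) ↔
      ∃ g, ∀ i j, ¬ ∀ a, Excl A (Seed A r c g) a i j := by
  refine ⟨?_, fun ⟨g, hg⟩ => h.colorable_of_excl g hg⟩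
  rintro ⟨f₀, hf₀⟩
  obtain ⟨f, hf, hT⟩ : ∃ f : ι → κ → Fin 3, (∀ i j k l, Incompat A i j k l → f i j ≠ f k l) ∧
      ∀ a, f (r a) (c a) = a := by
    have hinj : Function.Injective fun a => f₀ (r a) (c a) := by
      intro a b hab
      by_contra hne
      exact hf₀ _ _ _ _ (h.incompat hne) hab
    let σ := Equiv.ofBijective _ (Finite.injective_iff_bijective.1 hinj)
    refine ⟨fun i j => σ.symm (f₀ i j), fun i j k l hI heq => ?_, fun a => ?_⟩
    · exact hf₀ _ _ _ _ hI (σ.symm.injective heq)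
    · exact σ.symm_apply_apply a
  suffices H : ∃ g, ∀ a i j, Seed A r c g a i j → f i j = a by
    obtain ⟨g, hg⟩ := H
    exact ⟨g, fun i j hall => (hall (f i j)).ne hf hg rfl⟩
  by_cases hz : A (r 0) (c 1) + A (r 1) (c 2) + A (r 2) (c 0) ≤
      A (r 0) (c 0) + A (r 1) (c 1) + A (r 2) (c 2)
  swap
  · refine ⟨true, fun a i j hS => ?_⟩
    rcases hS with ⟨rfl, rfl⟩ | hS
    exacts [hT a, absurd hS.1 hz]
  have i01 := h.h01
  have i02 := h.h02
  have i12 := h.h12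
  have hlt := h.lt
  have hle := h.le
  unfold Incompat at i01 i02 i12
  have n1 : f (r 0) (c 1) ≠ 2 := by
    rw [← hT 2]
    refine hf _ _ _ _ ?_
    unfold Incompat
    linarith
  have n2 : f (r 1) (c 2) ≠ 0 := by
    rw [← hT 0]
    refine hf _ _ _ _ ?_
    unfold Incompat
    linarith
  have n3 : f (r 2) (c 0) ≠ 1 := by
    rw [← hT 1]
    refine hf _ _ _ _ ?_
    unfold Incompat
    linarith
  have d1 : f (r 0) (c 1) ≠ f (r 1) (c 2) := by
    refine hf _ _ _ _ ?_
    unfold Incompat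
    linarith
  have d2 : f (r 0) (c 1) ≠ f (r 2) (c 0) := by
    refine hf _ _ _ _ ?_
    unfold Incompat
    linarith
  have d3 : f (r 1) (c 2) ≠ f (r 2) (c 0) := by
    refine hf _ _ _ _ ?_
    unfold Incompat
    linarith
  -- Each tying entry avoids the colour of the triangle entry sharing neither its row nor its
  -- column, and the three are pairwise incompatible.
  have key : (f (r 0) (c 1) = 0 ∧ f (r 1) (c 2) = 1 ∧ f (r 2) (c 0) = 2) ∨
      (f (r 0) (c 1) = 1 ∧ f (r 1) (c 2) = 2 ∧ f (r 2) (c 0) = 0) := by omega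
  rcases key with ⟨e1, e2, e3⟩ | ⟨e1, e2, e3⟩
  · refine ⟨true, fun a i j hS => ?_⟩
    rcases hS with ⟨rfl, rfl⟩ | ⟨-, hS⟩
    · exact hT a
    · obtain ⟨rfl, rfl⟩ := hS
      fin_cases a
      exacts [e1, e2, e3]
  · refine ⟨false, fun a i j hS => ?_⟩
    rcases hS with ⟨rfl, rfl⟩ | ⟨-, hS⟩
    · exact hT a
    · simp only [Bool.false_eq_true, if_false] at hS
      obtain ⟨rfl, rfl⟩ := hS
      fin_cases a
      exacts [e3, e1, e2]

/-! ### Matrices without triangles -/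

/-- Adding the three incompatibilities shows that twice the diagonal sum is less than the sum of the
two cyclic ones. So at most one cyclic sum is as small as the diagonal; if one is smaller, its
entries are again pairwise incompatible and replace the diagonal. -/
theorem exists_tri {i₀ i₁ i₂ : ι} {j₀ j₁ j₂ : κ} (h01 : Incompat A i₀ j₀ i₁ j₁)
    (h02 : Incompat A i₀ j₀ i₂ j₂) (h12 : Incompat A i₁ j₁ i₂ j₂) : ∃ r c, Tri A r c := by
  unfold Incompat at h01 h02 h12
  rcases lt_or_ge (A i₀ j₁ + A i₁ j₂ + A i₂ j₀) (A i₀ j₀ + A i₁ j₁ + A i₂ j₂) with h1 | h1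
  · refine ⟨![i₀, i₁, i₂], ![j₁, j₂, j₀], ?_, ?_, ?_, ?_, ?_⟩ <;> simp [Incompat] <;> linarith
  rcases lt_or_ge (A i₀ j₂ + A i₁ j₀ + A i₂ j₁) (A i₀ j₀ + A i₁ j₁ + A i₂ j₂) with h2 | h2
  · refine ⟨![i₀, i₁, i₂], ![j₂, j₀, j₁], ?_, ?_, ?_, ?_, ?_⟩ <;> simp [Incompat] <;> linarith
  rcases h2.lt_or_eq with h3 | h3
  · refine ⟨![i₀, i₁, i₂], ![j₀, j₁, j₂], ?_, ?_, ?_, ?_, ?_⟩ <;> simp [Incompat] <;> linarith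
  -- Swapping two indices exchanges the two cycles, so that the tie is the one allowed by `Tri.le`.
  · refine ⟨![i₀, i₂, i₁], ![j₀, j₂, j₁], ?_, ?_, ?_, ?_, ?_⟩ <;> simp [Incompat] <;> linarith

/-- Without triangles, the larger of two sums in a pair of incompatible entries with the largest
gap bounds the matrix by a matrix of rank one. -/
theorem le_of_no_tri (h : ∀ r c, ¬ Tri A r c) {i₀ i₁ : ι} {j₀ j₁ : κ}
    (hmax : ∀ i j k l, A i l + A k j - A i j - A k l ≤ A i₀ j₁ + A i₁ j₀ - A i₀ j₀ - A i₁ j₁)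
    (i : ι) (j : κ) : A i j + A i₀ j₀ ≤ A i j₀ + A i₀ j := by
  by_contra! hlt
  -- If the bound fails, `(i, j₀)` and `(i₀, j)` are incompatible, and by maximality of the gap both
  -- are incompatible with `(i₁, j₁)`.
  have h1 := hmax i₀ j i j₁
  have h2 := hmax i j₀ i₁ j
  obtain ⟨r, c, hT⟩ : ∃ r c, Tri A r c := by
    refine exists_tri (i₀ := i) (j₀ := j₀) (i₁ := i₀) (j₁ := j) (i₂ := i₁) (j₂ := j₁) ?_ ?_ ?_ <;>
      unfold Incompat <;> linarith
  exact h r c hT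

theorem colorable_of_no_tri [Finite ι] [Finite κ] (h : ∀ r c, ¬ Tri A r c) :
    ∃ f : ι → κ → Fin 3, ∀ i j k l, Incompat A i j k l → f i j ≠ f k l := by
  classical
  by_cases hne : ∃ i j k l, Incompat A i j k l
  swap
  · push Not at hne
    exact ⟨fun _ _ => 0, fun i j k l hI => absurd hI (hne i j k l)⟩
  obtain ⟨x, y, z, w, hI⟩ := hne
  have : Nonempty (ι × κ × ι × κ) := ⟨(x, y, z, w)⟩
  obtain ⟨⟨i₀, j₀, i₁, j₁⟩, hmax⟩ := Finite.exists_max fun p : ι × κ × ι × κ =>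
    A p.1 p.2.2.2 + A p.2.2.1 p.2.1 - A p.1 p.2.1 - A p.2.2.1 p.2.2.2
  simp only [Prod.forall] at hmax
  have hI0 : Incompat A i₀ j₀ i₁ j₁ := by
    have := hmax x y z w
    unfold Incompat at *
    linarith
  have b0 := le_of_no_tri h (i₀ := i₀) (j₀ := j₀) (i₁ := i₁) (j₁ := j₁)
    fun i j k l => hmax i j k l
  have b1 := le_of_no_tri h (i₀ := i₁) (j₀ := j₁) (i₁ := i₀) (j₁ := j₀)
    fun i j k l => by linarith [hmax i j k l]
  have hno : ∀ i j, Incompat A i₀ j₀ i j → ¬ Incompat A i₁ j₁ i j := by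
    intro i j hu hu'
    obtain ⟨r, c, hT⟩ := exists_tri hI0 hu hu'
    exact h r c hT
  refine ⟨fun i j => if Incompat A i₀ j₀ i j then 0 else 1, fun i j k l hI heq => ?_⟩
  dsimp only at heq
  -- Entries of colour 0 are compatible with `(i₁, j₁)`, those of colour 1 with `(i₀, j₀)`. Equally
  -- coloured entries thus attain a common upper bound of rank one, and such entries are compatible.
  have c0 := b0 i l
  have c1 := b0 k j
  have c2 := b1 i l
  have c3 := b1 k j
  by_cases hu : Incompat A i₀ j₀ i j <;> by_cases hw : Incompat A i₀ j₀ k l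
  · have e1 := hno i j hu
    have e2 := hno k l hw
    unfold Incompat at *
    linarith
  · simp [hu, hw] at heq
  · simp [hu, hw] at heq
  · unfold Incompat at *
    linarith

end TropRank

/-! ### A Hoare logic with step bounds -/

namespace RealRAM

/-- The contents of the tables. -/
abbrev Tab := ℕ → ℕ → ℕ → ℕ

/-- The tables after storing the value `v`. -/
def upd (t : Tab) (a i j v : ℕ) : Tab :=
  fun a' i' j' => if a' = a ∧ i' = i ∧ j' = j then v else t a' i' j'

theorem upd_of_ne {t : Tab} {a a' : ℕ} (h : a' ≠ a) (i j v : ℕ) : upd t a i j v a' = t a' := by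
  funext i' j'
  simp [upd, h]

theorem upd_self (t : Tab) (a i j v : ℕ) : upd t a i j v a i j = v := by simp [upd]

theorem upd_ne_zero {t : Tab} {a i j v a' i' j' : ℕ} (hv : v ≠ 0) (h : t a' i' j' ≠ 0) :
    upd t a i j v a' i' j' ≠ 0 := by
  unfold upd
  split_ifs
  exacts [hv, h]

/-- Started with the index registers below `K` given by `e`, the input array `A` and the tables `t`,
the program `P` halts within `T` steps, preserves these registers and the input array, and ends
with tables satisfying `Q`. -/
def Run (A : ℕ → ℕ → ℝ) (K : ℕ) (e : ℕ → ℕ) (P : Cmd) (T : ℕ) (t : Tab) (Q : Tab → Prop) : Prop :=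
  ∀ s : State, (∀ x < K, s.idx x = e x) → s.mem 0 = A → s.tab = t →
    ∃ (τ : ℕ) (s' : State), Exec P s τ s' ∧ τ ≤ T ∧ (∀ x < K, s'.idx x = e x) ∧ s'.mem 0 = A ∧
      Q s'.tab

namespace Run

variable {A : ℕ → ℕ → ℝ} {K : ℕ} {e : ℕ → ℕ} {P R : Cmd} {T T' : ℕ} {t : Tab} {Q Q' : Tab → Prop}

theorem mono (h : Run A K e P T t Q) (hT : T ≤ T') (hQ : ∀ t', Q t' → Q' t') :
    Run A K e P T' t Q' := by
  intro s h1 h2 h3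
  obtain ⟨τ, s', hE, hτ, h4, h5, h6⟩ := h s h1 h2 h3
  exact ⟨τ, s', hE, hτ.trans hT, h4, h5, hQ _ h6⟩

theorem seq (h : Run A K e P T t Q') (h' : ∀ t', Q' t' → Run A K e R T' t' Q) :
    Run A K e (.seq P R) (T + T') t Q := by
  intro s h1 h2 h3
  obtain ⟨τ, s', hE, hτ, h4, h5, h6⟩ := h s h1 h2 h3
  obtain ⟨τ', s'', hE', hτ', h7, h8, h9⟩ := h' _ h6 s' h4 h5 rfl
  exact ⟨τ + τ', s'', .seq hE hE', add_le_add hτ hτ', h7, h8, h9⟩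

theorem skip (h : Q t) : Run A K e .skip 1 t Q := fun s h1 h2 h3 =>
  ⟨1, s, .skip s, le_rfl, h1, h2, h3 ▸ h⟩

theorem store {a i j x : ℕ} (hi : i < K) (hj : j < K) (hx : x < K)
    (h : Q (upd t a (e i) (e j) (e x))) : Run A K e (.storeIdx ⟨a, i, j⟩ x) 1 t Q := by
  intro s h1 h2 h3
  refine ⟨1, _, .storeIdx s _ _, le_rfl, h1, h2, ?_⟩
  convert h using 1
  funext a' i' j'
  simp [State.setTab, upd, h1 i hi, h1 j hj, h1 x hx, h3]

theorem load {a i j : ℕ} (hi : i < K) (hj : j < K)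
    (h : Run A (K + 1) (Function.update e K (t a (e i) (e j))) P T t Q) :
    Run A K e (.seq (.loadIdx K ⟨a, i, j⟩) P) (T + 1) t Q := by
  intro s h1 h2 h3
  obtain ⟨τ, s', hE, hτ, h4, h5, h6⟩ := h (s.setIdx K (s.getTab ⟨a, i, j⟩)) (by
    intro x hx
    rcases Nat.lt_succ_iff_lt_or_eq.1 hx with hx | rfl
    · simp [State.setIdx, hx.ne, h1 x hx]
    · simp [State.setIdx, State.getTab, h1 i hi, h1 j hj, h3]) h2 h3
  refine ⟨1 + τ, s', .seq (.loadIdx s _ _) hE, by omega, fun x hx => ?_, h5, h6⟩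
  rw [h4 x (hx.trans K.lt_succ_self), Function.update_of_ne hx.ne]

end Run

/-- Branching on whether an entry of a table is nonzero; register `4` has to hold `1`. -/
def ifBit (K a i j : ℕ) (P R : Cmd) : Cmd :=
  .seq (.loadIdx K ⟨a, i, j⟩) (.ite (.idxLE 4 K) P R)

/-- Registers from `K` on are scratch, so a load into register `K` does not affect the
specification. -/
theorem Run.weaken {A : ℕ → ℕ → ℝ} {K : ℕ} {e : ℕ → ℕ} {P : Cmd} {T : ℕ} {t : Tab}
    {Q : Tab → Prop} (h : Run A K e P T t Q) (s : State) (v : ℕ)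
    (h1 : ∀ x < K, s.idx x = e x) (h2 : s.mem 0 = A) (h3 : s.tab = t) :
    ∃ (τ : ℕ) (s' : State), Exec P (s.setIdx K v) τ s' ∧ τ ≤ T ∧ (∀ x < K, s'.idx x = e x) ∧
      s'.mem 0 = A ∧ Q s'.tab :=
  h _ (fun x hx => by simp [State.setIdx, hx.ne, h1 x hx]) h2 h3

theorem Run.ifBit {A : ℕ → ℕ → ℝ} {K : ℕ} {e : ℕ → ℕ} {P R : Cmd} {T : ℕ} {t : Tab}
    {Q : Tab → Prop} {a i j : ℕ} (hi : i < K) (hj : j < K) (hK : 4 < K) (he : e 4 = 1)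
    (h : t a (e i) (e j) ≠ 0 → Run A K e P T t Q) (h' : t a (e i) (e j) = 0 → Run A K e R T t Q) :
    Run A K e (ifBit K a i j P R) (T + 2) t Q := by
  intro s h1 h2 h3
  have hv : s.getTab ⟨a, i, j⟩ = t a (e i) (e j) := by
    simp [State.getTab, h1 i hi, h1 j hj, h3]
  have hb : (Test.idxLE 4 K).Holds (s.setIdx K (s.getTab ⟨a, i, j⟩)) ↔ t a (e i) (e j) ≠ 0 := by
    simp [Test.Holds, State.setIdx, hK.ne, h1 4 hK, he, hv, Nat.one_le_iff_ne_zero]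
  by_cases hc : t a (e i) (e j) = 0
  · obtain ⟨τ, s', hE, hτ, h4⟩ := (h' hc).weaken s (s.getTab ⟨a, i, j⟩) h1 h2 h3
    exact ⟨1 + (1 + τ), s', .seq (.loadIdx s _ _) (.iteFalse (fun hn => hb.1 hn hc) hE),
      by omega, h4⟩
  · obtain ⟨τ, s', hE, hτ, h4⟩ := (h hc).weaken s (s.getTab ⟨a, i, j⟩) h1 h2 h3
    exact ⟨1 + (1 + τ), s', .seq (.loadIdx s _ _) (.iteTrue (hb.2 hc) hE), by omega, h4⟩

/-- The loop in which register `K` runs from `0` to the value of register `y`; register `4` has to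
hold `1`. -/
def forLoop (K y : ℕ) (P : Cmd) : Cmd :=
  .seq (.idxConst K 0) (.while (.idxLE K y) (.seq P (.idxOp .add K K 4)))

theorem Run.forLoop {A : ℕ → ℕ → ℝ} {K : ℕ} {e : ℕ → ℕ} {P : Cmd} {T : ℕ} {t : Tab} {y N : ℕ}
    (I : ℕ → Tab → Prop) (hy : y < K) (hK : 4 < K) (he : e 4 = 1) (hN : e y + 1 = N) (hT : 1 ≤ T)
    (h : ∀ (k : Fin N) (t : Tab), I k t →
      Run A (K + 1) (Function.update e K k) P T t (I (k + 1))) (h0 : I 0 t) :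
    Run A K e (forLoop K y P) (5 * N * T) t (I N) := by
  have loop : ∀ d k, k + d = N → ∀ s : State, (∀ x < K, s.idx x = e x) → s.idx K = k →
      s.mem 0 = A → I k s.tab → ∃ (τ : ℕ) (s' : State),
        Exec (.while (.idxLE K y) (.seq P (.idxOp .add K K 4))) s τ s' ∧ τ ≤ d * (T + 2) + 1 ∧
          (∀ x < K, s'.idx x = e x) ∧ s'.mem 0 = A ∧ I N s'.tab := by
    intro d
    induction d with
    | zero =>
      intro k hk s h1 h2 h3 h4
      refine ⟨1, s, .whileFalse ?_, by omega, h1, h3, ?_⟩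
      · simp only [Test.Holds, h1 y hy, h2]
        omega
      · rwa [← hk, add_zero]
    | succ d ih =>
      intro k hk s h1 h2 h3 h4
      obtain ⟨τ, s', hE, hτ, h5, h6, h7⟩ := h ⟨k, by omega⟩ s.tab h4 s (by
        intro x hx
        rcases Nat.lt_succ_iff_lt_or_eq.1 hx with hx | rfl
        · rw [Function.update_of_ne hx.ne, h1 x hx]
        · rw [Function.update_self, h2]) h3 rfl
      have e1 : ∀ x < K, s'.idx x = e x := fun x hx => by
        rw [h5 x (by omega), Function.update_of_ne hx.ne]
      have e2 : s'.idx K = k := by rw [h5 K (by omega), Function.update_self]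
      obtain ⟨τ', s'', hE', hτ', h8⟩ := ih (k + 1) (by omega)
        (s'.setIdx K (IdxOp.add.eval (s'.idx K) (s'.idx 4)))
        (fun x hx => by simp [State.setIdx, hx.ne, e1 x hx])
        (by simp [State.setIdx, IdxOp.eval, e1 4 hK, e2, he]) h6 h7
      refine ⟨1 + (τ + 1) + τ', s'', .whileTrue ?_ (.seq hE (.idxOp s' _ _ _ _)) hE', ?_, h8⟩
      · simp only [Test.Holds, h1 y hy, h2]
        omega
      · rw [Nat.succ_mul]
        omega
  intro s h1 h2 h3
  obtain ⟨τ, s', hE, hτ, h4⟩ := loop N 0 (by omega) (s.setIdx K 0)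
    (fun x hx => by simp [State.setIdx, hx.ne, h1 x hx]) (by simp [State.setIdx]) h2 (h3 ▸ h0)
  refine ⟨1 + τ, s', .seq (.idxConst s _ _) hE, ?_, h4⟩
  -- The loop takes at most `N * (T + 2) + 2` steps, which is at most `5 * N * T` as `N, T ≥ 1`; the
  -- product form keeps nested bounds simple.
  have : 1 ≤ N := by omega
  nlinarith

/-- Sums of entries of the input array, computed in entry `(5, 5)` of the array `d`. -/
def sumCmd (d : ℕ) : List (ℕ × ℕ) → Cmd
  | [] => .realConst ⟨d, 5, 5⟩ 0
  | p :: L => .seq (sumCmd d L) (.realOp .add ⟨d, 5, 5⟩ ⟨d, 5, 5⟩ ⟨0, p.1, p.2⟩)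

/-- The sum of the entries of `A` that are addressed by the registers in the list `L`. -/
def sumVal (A : ℕ → ℕ → ℝ) (e : ℕ → ℕ) (L : List (ℕ × ℕ)) : ℝ :=
  (L.map fun p => A (e p.1) (e p.2)).sum

theorem exec_sumCmd {A : ℕ → ℕ → ℝ} {K : ℕ} {e : ℕ → ℕ} {d : ℕ} (hd : d ≠ 0) (L : List (ℕ × ℕ))
    (hL : ∀ p ∈ L, p.1 < K ∧ p.2 < K) (s : State) (h1 : ∀ x < K, s.idx x = e x)
    (h2 : s.mem 0 = A) : ∃ s' : State, Exec (sumCmd d L) s (L.length + 1) s' ∧ s'.idx = s.idx ∧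
      s'.tab = s.tab ∧ (∀ d', d' ≠ d → s'.mem d' = s.mem d') ∧
      s'.getMem ⟨d, 5, 5⟩ = sumVal A e L := by
  induction L with
  | nil =>
    refine ⟨_, .realConst s _ _, rfl, rfl, fun d' hd' => ?_, ?_⟩
    · funext i j
      simp [State.setMem, hd']
    · simp [State.setMem, State.getMem, sumVal]
  | cons p L ih =>
    obtain ⟨s', hE, h3, h4, h5, h6⟩ := ih fun q hq => hL q (List.mem_cons_of_mem _ hq)
    obtain ⟨hp1, hp2⟩ := hL p List.mem_cons_self
    refine ⟨_, .seq hE (.realOp s' _ _ _ _ (by simp)), h3, h4, fun d' hd' => ?_, ?_⟩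
    · rw [← h5 d' hd']
      funext i j
      simp [State.setMem, hd']
    · have h7 : s'.getMem ⟨0, p.1, p.2⟩ = A (e p.1) (e p.2) := by
        simp [State.getMem, h5 0 hd.symm, h3, h1 _ hp1, h1 _ hp2, h2]
      have h8 : sumVal A e (p :: L) = sumVal A e L + A (e p.1) (e p.2) := by
        simp [sumVal, add_comm]
      rw [h8, ← h6, ← h7]
      simp [State.setMem, State.getMem, RealOp.eval]

/-- Branching on whether one sum of entries of the input array is less than another one. -/
def ifLt (L M : List (ℕ × ℕ)) (P R : Cmd) : Cmd :=
  .seq (sumCmd 1 L) (.seq (sumCmd 2 M) (.ite (.realLE ⟨2, 5, 5⟩ ⟨1, 5, 5⟩) R P))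

theorem Run.ifLt {A : ℕ → ℕ → ℝ} {K : ℕ} {e : ℕ → ℕ} {P R : Cmd} {T : ℕ} {t : Tab}
    {Q : Tab → Prop} {L M : List (ℕ × ℕ)} (hL : ∀ p ∈ L, p.1 < K ∧ p.2 < K)
    (hM : ∀ p ∈ M, p.1 < K ∧ p.2 < K)
    (h : sumVal A e L < sumVal A e M → Run A K e P T t Q)
    (h' : sumVal A e M ≤ sumVal A e L → Run A K e R T t Q) :
    Run A K e (ifLt L M P R) (T + (L.length + M.length + 3)) t Q := by
  intro s h1 h2 h3
  obtain ⟨s₁, hE₁, a1, a2, a3, a4⟩ := exec_sumCmd one_ne_zero L hL s h1 h2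
  obtain ⟨s₂, hE₂, b1, b2, b3, b4⟩ := exec_sumCmd two_ne_zero M hM s₁
    (fun x hx => by rw [a1, h1 x hx]) ((a3 0 (by decide)).trans h2)
  have c1 : ∀ x < K, s₂.idx x = e x := fun x hx => by rw [b1, a1, h1 x hx]
  have c2 : s₂.mem 0 = A := by rw [b3 0 (by decide), a3 0 (by decide), h2]
  have c3 : s₂.tab = t := by rw [b2, a2, h3]
  have hb : (Test.realLE ⟨2, 5, 5⟩ ⟨1, 5, 5⟩).Holds s₂ ↔ sumVal A e M ≤ sumVal A e L := by
    have : s₂.getMem ⟨1, 5, 5⟩ = s₁.getMem ⟨1, 5, 5⟩ := by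
      simp [State.getMem, b1, b3 1 (by decide)]
    simp only [Test.Holds]
    rw [b4, this, a4]
  by_cases hc : sumVal A e M ≤ sumVal A e L
  · obtain ⟨τ, s', hE, hτ, h4⟩ := h' hc s₂ c1 c2 c3
    exact ⟨_, s', .seq hE₁ (.seq hE₂ (.iteTrue (hb.2 hc) hE)), by omega, h4⟩
  · obtain ⟨τ, s', hE, hτ, h4⟩ := h (not_le.1 hc) s₂ c1 c2 c3
    exact ⟨_, s', .seq hE₁ (.seq hE₂ (.iteFalse (fun hn => hc (hb.1 hn)) hE)), by omega, h4⟩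

/-! ### Programs that only add marks -/

/-- No mark is erased. The tables from number `6` on hold marks. -/
def Grow (t t' : Tab) : Prop := ∀ a i j, t (a + 6) i j ≠ 0 → t' (a + 6) i j ≠ 0

theorem Grow.refl (t : Tab) : Grow t t := fun _ _ _ h => h

theorem Grow.trans {t t' t'' : Tab} (h : Grow t t') (h' : Grow t' t'') : Grow t t'' :=
  fun a i j hm => h' a i j (h a i j hm)

theorem Grow.upd {t : Tab} (a i j : ℕ) {v : ℕ} (hv : v ≠ 0) : Grow t (upd t a i j v) :=
  fun _ _ _ h => upd_ne_zero hv h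

/-- The program `P` preserves `I`, erases no marks and sets all marks in `C`. -/
def Marks (A : ℕ → ℕ → ℝ) (K : ℕ) (e : ℕ → ℕ) (P : Cmd) (T : ℕ) (I : Tab → Prop)
    (C : Set (ℕ × ℕ × ℕ)) : Prop :=
  ∀ t, I t → Run A K e P T t fun t' =>
    I t' ∧ Grow t t' ∧ ∀ a i j, (a, i, j) ∈ C → t' (a + 6) i j ≠ 0

namespace Marks

variable {A : ℕ → ℕ → ℝ} {K : ℕ} {e : ℕ → ℕ} {P R : Cmd} {T T' : ℕ} {I : Tab → Prop}
  {C C' : Set (ℕ × ℕ × ℕ)}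

theorem mono (h : Marks A K e P T I C) (hT : T ≤ T') (hC : C' ⊆ C) : Marks A K e P T' I C' :=
  fun t ht => (h t ht).mono hT fun _ ⟨h1, h2, h3⟩ => ⟨h1, h2, fun a i j hm => h3 a i j (hC hm)⟩

theorem seq (h : Marks A K e P T I C) (h' : Marks A K e R T' I C') :
    Marks A K e (.seq P R) (T + T') I (C ∪ C') := fun t ht =>
  (h t ht).seq fun t' ⟨h1, h2, h3⟩ => (h' t' h1).mono le_rfl fun _ ⟨h4, h5, h6⟩ =>
    ⟨h4, h2.trans h5, fun a i j hm => hm.elim (fun hm => h5 a i j (h3 a i j hm)) (h6 a i j)⟩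

theorem skip : Marks A K e .skip 1 I ∅ := fun t ht =>
  Run.skip ⟨ht, Grow.refl t, fun _ _ _ h => h.elim⟩

theorem store {a i j : ℕ} (hi : i < K) (hj : j < K) (hK : 4 < K) (he : e 4 = 1)
    (h : ∀ t, I t → I (upd t (a + 6) (e i) (e j) 1)) :
    Marks A K e (.storeIdx ⟨a + 6, i, j⟩ 4) 1 I {(a, e i, e j)} := by
  intro t ht
  refine Run.store hi hj hK ?_
  rw [he]
  refine ⟨h t ht, Grow.upd _ _ _ one_ne_zero, fun a' i' j' hm => ?_⟩
  obtain ⟨rfl, rfl, rfl⟩ : a' = a ∧ i' = e i ∧ j' = e j := by simpa using hm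
  rw [upd_self]
  exact one_ne_zero

theorem ifLt {L M : List (ℕ × ℕ)} (hL : ∀ p ∈ L, p.1 < K ∧ p.2 < K)
    (hM : ∀ p ∈ M, p.1 < K ∧ p.2 < K)
    (h : sumVal A e L < sumVal A e M → Marks A K e P T I C)
    (h' : sumVal A e M ≤ sumVal A e L → Marks A K e R T I C) :
    Marks A K e (ifLt L M P R) (T + (L.length + M.length + 3)) I C := fun t ht =>
  Run.ifLt hL hM (fun hc => h hc t ht) (fun hc => h' hc t ht)

theorem load {a i j v : ℕ} (hi : i < K) (hj : j < K) (hv : ∀ t, I t → t a (e i) (e j) = v)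
    (h : Marks A (K + 1) (Function.update e K v) P T I C) :
    Marks A K e (.seq (.loadIdx K ⟨a, i, j⟩) P) (T + 1) I C := fun t ht =>
  Run.load hi hj (by rw [hv t ht]; exact h t ht)

/-- Marks are never erased, so those set by the single rounds accumulate. Register `y` holds `N - 1`
because the only comparison is `≤`. -/
theorem forLoop {y N : ℕ} {C : Fin N → Set (ℕ × ℕ × ℕ)} (hy : y < K) (hK : 4 < K) (he : e 4 = 1)
    (hN : e y + 1 = N) (hT : 1 ≤ T)
    (h : ∀ k : Fin N, Marks A (K + 1) (Function.update e K k) P T I (C k)) :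
    Marks A K e (forLoop K y P) (5 * N * T) I (⋃ k, C k) := by
  intro t ht
  refine (Run.forLoop (fun k t' => I t' ∧ Grow t t' ∧
    ∀ x : Fin N, (x : ℕ) < k → ∀ a i j, (a, i, j) ∈ C x → t' (a + 6) i j ≠ 0)
    hy hK he hN hT ?_ ⟨ht, Grow.refl t, by simp⟩).mono le_rfl ?_
  · rintro k t' ⟨h1, h2, h3⟩
    refine (h k t' h1).mono le_rfl ?_
    rintro t'' ⟨h4, h5, h6⟩
    refine ⟨h4, h2.trans h5, fun x hx a i j hm => ?_⟩
    rcases Nat.lt_succ_iff_lt_or_eq.1 hx with hx | hx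
    · exact h5 a i j (h3 x hx a i j hm)
    · exact h6 a i j (Fin.ext hx ▸ hm)
  · rintro t' ⟨h1, h2, h3⟩
    refine ⟨h1, h2, fun a i j hm => ?_⟩
    obtain ⟨k, hk⟩ := Set.mem_iUnion.1 hm
    exact h3 k k.2 a i j hk

end Marks

end RealRAM

/-! ### Memory layout and the search -/

namespace RealRAM

open TropRank

theorem Run.storeThen {A : ℕ → ℕ → ℝ} {K : ℕ} {e : ℕ → ℕ} {P : Cmd} {T : ℕ} {t : Tab}
    {Q : Tab → Prop} {a i j x : ℕ} (hi : i < K) (hj : j < K) (hx : x < K)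
    (h : Run A K e P T (upd t a (e i) (e j) (e x)) Q) :
    Run A K e (.seq (.storeIdx ⟨a, i, j⟩ x) P) (1 + T) t Q :=
  (Run.store hi hj hx rfl).seq fun _ ht => ht ▸ h

/-- The registers `2` to `5` hold `m - 1`, `n - 1`, `1` and `0`. -/
structure Env (m n : ℕ) (e : ℕ → ℕ) : Prop where
  rows : e 2 + 1 = m
  cols : e 3 + 1 = n
  one : e 4 = 1
  zero : e 5 = 0

theorem Env.update {m n : ℕ} {e : ℕ → ℕ} (h : Env m n e) {x : ℕ} (hx : 5 < x) (v : ℕ) :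
    Env m n (Function.update e x v) where
  rows := by rw [Function.update_of_ne (by omega), h.rows]
  cols := by rw [Function.update_of_ne (by omega), h.cols]
  one := by rw [Function.update_of_ne (by omega), h.one]
  zero := by rw [Function.update_of_ne (by omega), h.zero]

/-- The tables `0` to `5` hold the triangle with rows `r` and columns `c`. -/
def Holds {m n : ℕ} (t : Tab) (r : Fin 3 → Fin m) (c : Fin 3 → Fin n) : Prop :=
  (t 0 0 0 = r 0 ∧ t 1 0 0 = r 1 ∧ t 2 0 0 = r 2) ∧ t 3 0 0 = c 0 ∧ t 4 0 0 = c 1 ∧ t 5 0 0 = c 2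

/-! ### The search for a triangle -/

/-- Stores the registers `8` to `13` and sets the mark of table `12`. -/
def storeTri : Cmd :=
  .seq (.storeIdx ⟨0, 5, 5⟩ 8) (.seq (.storeIdx ⟨1, 5, 5⟩ 9) (.seq (.storeIdx ⟨2, 5, 5⟩ 10)
    (.seq (.storeIdx ⟨3, 5, 5⟩ 11) (.seq (.storeIdx ⟨4, 5, 5⟩ 12) (.seq (.storeIdx ⟨5, 5, 5⟩ 13)
      (.storeIdx ⟨12, 5, 5⟩ 4))))))

/-- Stores the registers `8` to `13` if they form a triangle. -/
def testTri : Cmd :=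
  ifLt [(8, 11), (9, 12)] [(8, 12), (9, 11)]
    (ifLt [(8, 11), (10, 13)] [(8, 13), (10, 11)]
      (ifLt [(9, 12), (10, 13)] [(9, 13), (10, 12)]
        (ifLt [(8, 11), (9, 12), (10, 13)] [(8, 13), (9, 11), (10, 12)]
          (ifLt [(8, 12), (9, 13), (10, 11)] [(8, 11), (9, 12), (10, 13)] .skip storeTri)
          .skip) .skip) .skip) .skip

/-- Searches for a triangle. -/
def search : Cmd :=
  forLoop 8 2 (forLoop 9 2 (forLoop 10 2 (forLoop 11 3 (forLoop 12 3 (forLoop 13 3 testTri)))))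

/-- During the search, table `12` tells whether a triangle has been found. -/
structure Searched {m n : ℕ} (A : Matrix (Fin m) (Fin n) ℝ) (t : Tab) : Prop where
  clear : ∀ a, 6 ≤ a → a ≠ 12 → t a = fun _ _ => 0
  found : t 12 0 0 ≠ 0 → ∃ r c, Tri A r c ∧ Holds t r c

section

variable {m n : ℕ} {A : Matrix (Fin m) (Fin n) ℝ} {A' : ℕ → ℕ → ℝ} {e : ℕ → ℕ}

/-- A triangle stored earlier may be overwritten: tables 0 to 5 are exempt from `Grow`, and any
triangle will do. -/
theorem marks_storeTri (he : Env m n e) {i₀ i₁ i₂ : Fin m} {j₀ j₁ j₂ : Fin n}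
    (hT : Tri A ![i₀, i₁, i₂] ![j₀, j₁, j₂]) (e8 : e 8 = i₀) (e9 : e 9 = i₁) (e10 : e 10 = i₂)
    (e11 : e 11 = j₀) (e12 : e 12 = j₁) (e13 : e 13 = j₂) :
    Marks A' 14 e storeTri 7 (Searched A) {(6, 0, 0)} := by
  intro t ht
  have h5 := he.zero
  refine (Run.storeThen (by omega) (by omega) (by omega) <|
    Run.storeThen (by omega) (by omega) (by omega) <|
    Run.storeThen (by omega) (by omega) (by omega) <|
    Run.storeThen (by omega) (by omega) (by omega) <|
    Run.storeThen (by omega) (by omega) (by omega) <|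
    Run.storeThen (by omega) (by omega) (by omega) <|
    Run.store (by omega) (by omega) (by omega) ?_)
  rw [h5, e8, e9, e10, e11, e12, e13, he.one]
  refine ⟨⟨fun a ha ha' => ?_, fun _ => ⟨_, _, hT, ?_⟩⟩, fun a i j h => ?_, ?_⟩
  · rw [upd_of_ne ha', upd_of_ne, upd_of_ne, upd_of_ne, upd_of_ne, upd_of_ne, upd_of_ne,
      ht.clear a ha ha'] <;> omega
  · simp [Holds, upd]
  · refine upd_ne_zero one_ne_zero ?_
    rwa [upd_of_ne, upd_of_ne, upd_of_ne, upd_of_ne, upd_of_ne, upd_of_ne] <;> omega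
  · rintro a i j h
    obtain ⟨rfl, rfl, rfl⟩ : a = 6 ∧ i = 0 ∧ j = 0 := by simpa using h
    simp [upd]

theorem marks_testTri (hA : ∀ (i : Fin m) (j : Fin n), A' i j = A i j) (he : Env m n e)
    {i₀ i₁ i₂ : Fin m} {j₀ j₁ j₂ : Fin n} (e8 : e 8 = i₀) (e9 : e 9 = i₁) (e10 : e 10 = i₂)
    (e11 : e 11 = j₀) (e12 : e 12 = j₁) (e13 : e 13 = j₂) :
    Marks A' 14 e testTri 46 (Searched A)
      {p | p = (6, 0, 0) ∧ Tri A ![i₀, i₁, i₂] ![j₀, j₁, j₂]} := by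
  have hskip (h : ¬ Tri A ![i₀, i₁, i₂] ![j₀, j₁, j₂]) (T : ℕ) (hT : 1 ≤ T) :
      Marks A' 14 e .skip T (Searched A)
        {p | p = (6, 0, 0) ∧ Tri A ![i₀, i₁, i₂] ![j₀, j₁, j₂]} :=
    Marks.skip.mono hT fun p hp => h hp.2
  -- Comparing sums of two entries costs 7 steps, of three entries 9, and storing costs 7.
  refine Marks.ifLt (T := 37 + 2) (by simp) (by simp) (fun h01 => Marks.ifLt (T := 32) (by simp)
    (by simp) (fun h02 => Marks.ifLt (T := 25) (by simp) (by simp) (fun h12 => Marks.ifLt (T := 16)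
    (by simp) (by simp) (fun hlt => Marks.ifLt (T := 7) (by simp) (by simp) (fun hle => ?_)
    (fun hle => ?_)) (fun hlt => ?_)) (fun h12 => ?_)) (fun h02 => ?_)) (fun h01 => ?_)
  case refine_2 =>
    refine Marks.mono (C := {(6, 0, 0)}) ?_ le_rfl (fun p hp => hp.1)
    refine marks_storeTri he ⟨?_, ?_, ?_, ?_, ?_⟩ e8 e9 e10 e11 e12 e13
    all_goals
      simp [sumVal, e8, e9, e10, e11, e12, e13, hA] at h01 h02 h12 hlt hle
      simp [Incompat]
      linarith
  all_goals
    refine hskip (fun hT => ?_) _ (by norm_num)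
    obtain ⟨a1, a2, a3, a4, a5⟩ := hT
    simp [Incompat] at a1 a2 a3 a4 a5
    simp [sumVal, e8, e9, e10, e11, e12, e13, hA] at *
    linarith

theorem run_search (hA : ∀ (i : Fin m) (j : Fin n), A' i j = A i j) (he : Env m n e) {t : Tab}
    (ht : Searched A t) : Run A' 8 e search
      (5 * m * (5 * m * (5 * m * (5 * n * (5 * n * (5 * n * 46)))))) t
      fun t' => Searched A t' ∧ (t' 12 0 0 = 0 → ∀ r c, ¬ Tri A r c) := by
  have hm : 1 ≤ m := by have := he.rows; omega
  have hn : 1 ≤ n := by have := he.cols; omega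
  have hbase (i₀ i₁ i₂ : Fin m) (j₀ j₁ j₂ : Fin n) := marks_testTri (i₀ := i₀) (i₁ := i₁) (i₂ := i₂)
    (j₀ := j₀) (j₁ := j₁) (j₂ := j₂) hA ((((((he.update (x := 8) (by omega) i₀).update (x := 9)
    (by omega) i₁).update (x := 10) (by omega) i₂).update (x := 11) (by omega) j₀).update (x := 12)
    (by omega) j₁).update (x := 13) (by omega) j₂) (by simp) (by simp) (by simp) (by simp) (by simp)
    (by simp)
  have pos {a b : ℕ} (ha : 1 ≤ a) (hb : 1 ≤ b) : 1 ≤ 5 * a * b := by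
    have := Nat.mul_pos (Nat.mul_pos (by norm_num : 0 < 5) ha) hb
    omega
  have p1 := pos hn (by norm_num : 1 ≤ 46)
  have p2 := pos hn p1
  have p3 := pos hn p2
  have p4 := pos hm p3
  have p5 := pos hm p4
  have key := Marks.forLoop (by omega) (by omega) he.one he.rows p5 fun i₀ : Fin m =>
    have he := he.update (x := 8) (by omega) i₀
    Marks.forLoop (by omega) (by omega) he.one he.rows p4 fun i₁ : Fin m =>
    have he := he.update (x := 9) (by omega) i₁
    Marks.forLoop (by omega) (by omega) he.one he.rows p3 fun i₂ : Fin m =>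
    have he := he.update (x := 10) (by omega) i₂
    Marks.forLoop (by omega) (by omega) he.one he.cols p2 fun j₀ : Fin n =>
    have he := he.update (x := 11) (by omega) j₀
    Marks.forLoop (by omega) (by omega) he.one he.cols p1 fun j₁ : Fin n =>
    have he := he.update (x := 12) (by omega) j₁
    Marks.forLoop (by omega) (by omega) he.one he.cols (by norm_num) fun j₂ : Fin n =>
    hbase i₀ i₁ i₂ j₀ j₁ j₂
  refine (key t ht).mono le_rfl ?_
  rintro t' ⟨h1, -, h2⟩
  refine ⟨h1, fun h0 r c hT => h2 6 0 0 ?_ h0⟩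
  simp only [Set.mem_iUnion]
  refine ⟨r 0, r 1, r 2, c 0, c 1, c 2, rfl, ?_⟩
  convert hT using 1 <;> (funext x; fin_cases x <;> rfl)

end

end RealRAM

namespace RealRAM

open TropRank

section

variable {m n : ℕ} {A : Matrix (Fin m) (Fin n) ℝ} {A' : ℕ → ℕ → ℝ} {e : ℕ → ℕ} {o : ℕ}
  {X : Fin 3 → Fin m → Fin n → Prop} {t₀ : Tab}

/-- The tables `t` arise from `t₀` by setting marks in the tables `o + 6`, `o + 7`, `o + 8` as
permitted by `X` and in table `o + 13` if `X` permits three marks for one entry. -/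
structure Sound (o : ℕ) (X : Fin 3 → Fin m → Fin n → Prop) (t₀ t : Tab) : Prop where
  frame : ∀ a, a < o + 6 ∨ o + 8 < a ∧ a ≠ o + 13 → t a = t₀ a
  bits : ∀ (a : Fin 3) (i : Fin m) (j : Fin n), t (o + a + 6) i j ≠ 0 → X a i j
  flag : t (o + 7 + 6) 0 0 ≠ 0 → ∃ i j, ∀ a, X a i j

theorem Sound.upd {t : Tab} (h : Sound o X t₀ t) {a : Fin 3} {i : Fin m} {j : Fin n}
    (hX : X a i j) : Sound o X t₀ (upd t (o + a + 6) i j 1) where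
  frame b hb := by rw [upd_of_ne (by omega), h.frame b hb]
  bits b k l hb := by
    by_cases hc : b = a ∧ k = i ∧ l = j
    · obtain ⟨rfl, rfl, rfl⟩ := hc
      exact hX
    · refine h.bits b k l fun h0 => hb ?_
      rw [RealRAM.upd, if_neg, h0]
      exact fun hd => hc ⟨by omega, by omega, by omega⟩
  flag hb := h.flag (by rwa [upd_of_ne (by omega)] at hb)

theorem Sound.upd_flag {t : Tab} (h : Sound o X t₀ t) (hX : ∃ i j, ∀ a, X a i j) :
    Sound o X t₀ (RealRAM.upd t (o + 7 + 6) 0 0 1) where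
  frame b hb := by rw [upd_of_ne (by omega), h.frame b hb]
  bits b k l hb := h.bits b k l (by rwa [upd_of_ne (by omega)] at hb)
  flag _ := hX

/-! ### Seeds -/

/-- Sets the marks `b` and `d` for the entry in row `x` and column `y`. -/
def markTwo (o x y b d : ℕ) : Cmd :=
  .seq (.storeIdx ⟨o + b + 6, x, y⟩ 4) (.storeIdx ⟨o + d + 6, x, y⟩ 4)

theorem marks_markTwo {x y : ℕ} (hx : x < 14) (hy : y < 14) (he : Env m n e) {a b d : Fin 3}
    (hab : a ≠ b) (had : a ≠ d) (hbd : b ≠ d) {i : Fin m} {j : Fin n} (hi : e x = i) (hj : e y = j)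
    (hX : ∀ b, b ≠ a → X b i j) : Marks A' 14 e (markTwo o x y b d) 2 (Sound o X t₀)
      {p | ∃ b : Fin 3, b ≠ a ∧ p = (o + b, (i : ℕ), (j : ℕ))} := by
  refine ((Marks.store hx hy (by omega) he.one fun t ht => ?_).seq
    (Marks.store hx hy (by omega) he.one fun t ht => ?_)).mono le_rfl ?_
  · rw [hi, hj]
    exact ht.upd (hX b hab.symm)
  · rw [hi, hj]
    exact ht.upd (hX d had.symm)
  · rintro p ⟨x, hx, rfl⟩
    rcases fin3_cases hab hbd had x with rfl | rfl | rfl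
    · exact absurd rfl hx
    · left
      rw [hi, hj]
      rfl
    · right
      rw [hi, hj]
      rfl

/-- Marks three entries, each with the colours that differ from its number. -/
def markTri (o x₀ y₀ x₁ y₁ x₂ y₂ : ℕ) : Cmd :=
  .seq (markTwo o x₀ y₀ 1 2) (.seq (markTwo o x₁ y₁ 0 2) (markTwo o x₂ y₂ 0 1))

theorem marks_markTri {x : Fin 3 → ℕ} {y : Fin 3 → ℕ} (hx : ∀ a, x a < 14) (hy : ∀ a, y a < 14)
    (he : Env m n e) {i : Fin 3 → Fin m} {j : Fin 3 → Fin n} (hi : ∀ a, e (x a) = i a)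
    (hj : ∀ a, e (y a) = j a) (hX : ∀ a b, b ≠ a → X b (i a) (j a)) :
    Marks A' 14 e (markTri o (x 0) (y 0) (x 1) (y 1) (x 2) (y 2)) 6 (Sound o X t₀)
      {p | ∃ a b : Fin 3, b ≠ a ∧ p = (o + b, (i a : ℕ), (j a : ℕ))} := by
  refine ((marks_markTwo (a := 0) (b := 1) (d := 2) (hx 0) (hy 0) he (by decide) (by decide)
    (by decide) (hi 0) (hj 0) (hX 0)).seq ((marks_markTwo (a := 1) (b := 0) (d := 2) (hx 1) (hy 1)
    he (by decide) (by decide) (by decide) (hi 1) (hj 1) (hX 1)).seq (marks_markTwo (a := 2)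
    (b := 0) (d := 1) (hx 2) (hy 2) he (by decide) (by decide) (by decide) (hi 2) (hj 2)
    (hX 2)))).mono le_rfl ?_
  rintro p ⟨a, b, hb⟩
  have ha : a = 0 ∨ a = 1 ∨ a = 2 := fin3_cases (by decide) (by decide) (by decide) a
  rcases ha with rfl | rfl | rfl
  exacts [.inl ⟨b, hb⟩, .inr (.inl ⟨b, hb⟩), .inr (.inr ⟨b, hb⟩)]

/-- Sets the marks that a triangle and the guess `g` determine. -/
def seeds (o : ℕ) (g : Bool) : Cmd :=
  .seq (.loadIdx 8 ⟨0, 5, 5⟩) (.seq (.loadIdx 9 ⟨1, 5, 5⟩) (.seq (.loadIdx 10 ⟨2, 5, 5⟩)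
    (.seq (.loadIdx 11 ⟨3, 5, 5⟩) (.seq (.loadIdx 12 ⟨4, 5, 5⟩) (.seq (.loadIdx 13 ⟨5, 5, 5⟩)
      (.seq (markTri o 8 11 9 12 10 13)
        (ifLt [(8, 11), (9, 12), (10, 13)] [(8, 12), (9, 13), (10, 11)] .skip
          (if g then markTri o 8 12 9 13 10 11 else markTri o 10 11 8 12 9 13))))))))

theorem marks_seeds (hA : ∀ (i : Fin m) (j : Fin n), A' i j = A i j) (he : Env m n e)
    {r : Fin 3 → Fin m} {c : Fin 3 → Fin n} (ht₀ : Holds t₀ r c) (g : Bool)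
    (hX : ∀ a b i j, Seed A r c g a i j → b ≠ a → X b i j) :
    Marks A' 8 e (seeds o g) 27 (Sound o X t₀) {p | ∃ (a b : Fin 3) (i : Fin m) (j : Fin n),
      Seed A r c g a i j ∧ b ≠ a ∧ p = (o + b, (i : ℕ), (j : ℕ))} := by
  obtain ⟨⟨h0, h1, h2⟩, h3, h4, h5⟩ := ht₀
  have hz : ∀ t, Sound o X t₀ t → t 0 0 0 = r 0 ∧ t 1 0 0 = r 1 ∧ t 2 0 0 = r 2 ∧ t 3 0 0 = c 0 ∧
      t 4 0 0 = c 1 ∧ t 5 0 0 = c 2 := fun t ht => by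
    rw [ht.frame 0 (by omega), ht.frame 1 (by omega), ht.frame 2 (by omega), ht.frame 3 (by omega),
      ht.frame 4 (by omega), ht.frame 5 (by omega)]
    exact ⟨h0, h1, h2, h3, h4, h5⟩
  have he8 := he.update (x := 8) (by omega) (r 0)
  have he9 := he8.update (x := 9) (by omega) (r 1)
  have he10 := he9.update (x := 10) (by omega) (r 2)
  have he11 := he10.update (x := 11) (by omega) (c 0)
  have he12 := he11.update (x := 12) (by omega) (c 1)
  have he13 := he12.update (x := 13) (by omega) (c 2)
  refine Marks.load (by omega) (by omega) (fun t ht => by rw [he.zero]; exact (hz t ht).1) <|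
    Marks.load (by omega) (by omega) (fun t ht => by rw [he8.zero]; exact (hz t ht).2.1) <|
    Marks.load (by omega) (by omega) (fun t ht => by rw [he9.zero]; exact (hz t ht).2.2.1) <|
    Marks.load (by omega) (by omega) (fun t ht => by rw [he10.zero]; exact (hz t ht).2.2.2.1) <|
    Marks.load (by omega) (by omega) (fun t ht => by rw [he11.zero]; exact (hz t ht).2.2.2.2.1) <|
    Marks.load (by omega) (by omega) (fun t ht => by rw [he12.zero]; exact (hz t ht).2.2.2.2.2) ?_
  generalize hw : Function.update (β := fun _ : ℕ => ℕ) _ 13 (c 2 : ℕ) = w at he13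
  have e8 : w 8 = r 0 := by simp [← hw]
  have e9 : w 9 = r 1 := by simp [← hw]
  have e10 : w 10 = r 2 := by simp [← hw]
  have e11 : w 11 = c 0 := by simp [← hw]
  have e12 : w 12 = c 1 := by simp [← hw]
  have e13 : w 13 = c 2 := by simp [← hw]
  have hd := marks_markTri (A' := A') (X := X) (t₀ := t₀) (o := o) (x := ![8, 9, 10])
    (y := ![11, 12, 13]) (i := r) (j := c) (by decide) (by decide) he13
    (by simp [Fin.forall_fin_succ, e8, e9, e10]) (by simp [Fin.forall_fin_succ, e11, e12, e13])
    (fun a b hb => hX a b _ _ (.inl ⟨rfl, rfl⟩) hb)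
  have hsum1 : sumVal A' w [(8, 11), (9, 12), (10, 13)] =
      A (r 0) (c 0) + A (r 1) (c 1) + A (r 2) (c 2) := by
    simp [sumVal, e8, e9, e10, e11, e12, e13, hA, add_assoc]
  have hsum2 : sumVal A' w [(8, 12), (9, 13), (10, 11)] =
      A (r 0) (c 1) + A (r 1) (c 2) + A (r 2) (c 0) := by
    simp [sumVal, e8, e9, e10, e11, e12, e13, hA, add_assoc]
  -- The branch only has to supply the seeds outside the triangle; without a tie there are none.
  refine (hd.seq (Marks.ifLt (T := 6) (C := {p | ∃ (a b : Fin 3) (i : Fin m) (j : Fin n),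
      Seed A r c g a i j ∧ ¬ (i = r a ∧ j = c a) ∧ b ≠ a ∧ p = (o + b, (i : ℕ), (j : ℕ))})
    (by simp) (by simp) (fun hlt => Marks.skip.mono (by norm_num) ?_) fun hle => ?_)).mono le_rfl ?_
  · rintro p ⟨a, b, i, j, hS, hn, -⟩
    rw [hsum1, hsum2] at hlt
    rcases hS with hS | hS
    exacts [hn hS, absurd hS.1 (not_le.2 hlt)]
  · rw [hsum1, hsum2] at hle
    cases g
    · refine (marks_markTri (x := ![10, 8, 9]) (y := ![11, 12, 13]) (i := fun a => r (a + 2))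
        (j := c) (by decide) (by decide) he13 ?_ ?_ fun a b hb => ?_).mono le_rfl ?_
      · intro a
        fin_cases a
        exacts [e10, e8, e9]
      · simp [Fin.forall_fin_succ, e11, e12, e13]
      · exact hX a b _ _ (.inr ⟨hle, ⟨rfl, rfl⟩⟩) hb
      · rintro p ⟨a, b, i, j, hS | ⟨-, hS⟩, hn, hb, rfl⟩
        · exact absurd hS hn
        · obtain ⟨rfl, rfl⟩ : i = r (a + 2) ∧ j = c a := hS
          exact ⟨a, b, hb, rfl⟩
    · refine (marks_markTri (x := ![8, 9, 10]) (y := ![12, 13, 11]) (i := r)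
        (j := fun a => c (a + 1)) (by decide) (by decide) he13 ?_ ?_ fun a b hb => ?_).mono le_rfl ?_
      · simp [Fin.forall_fin_succ, e8, e9, e10]
      · intro a
        fin_cases a
        exacts [e12, e13, e11]
      · exact hX a b _ _ (.inr ⟨hle, ⟨rfl, rfl⟩⟩) hb
      · rintro p ⟨a, b, i, j, hS | ⟨-, hS⟩, hn, hb, rfl⟩
        · exact absurd hS hn
        · obtain ⟨rfl, rfl⟩ : i = r a ∧ j = c (a + 1) := hS
          exact ⟨a, b, hb, rfl⟩
  · rintro p ⟨a, b, i, j, hS, hb, rfl⟩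
    by_cases hn : i = r a ∧ j = c a
    · obtain ⟨rfl, rfl⟩ := hn
      exact .inl ⟨a, b, hb, rfl⟩
    · exact .inr ⟨a, b, i, j, hS, hn, hb, rfl⟩

end

end RealRAM

namespace RealRAM

open TropRank

section

variable {m n : ℕ} {A : Matrix (Fin m) (Fin n) ℝ} {A' : ℕ → ℕ → ℝ} {e : ℕ → ℕ} {o : ℕ}
  {S X : Fin 3 → Fin m → Fin n → Prop} {t₀ : Tab}

/-! ### Propagation -/

/-- Sets the mark `a` for the entry in row `10` and column `11` if the entry in row `12` and column
`13` has the marks `b` and `d`. -/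
def propagate (o a b d : ℕ) : Cmd :=
  ifBit 14 (o + b + 6) 12 13 (ifBit 14 (o + d + 6) 12 13 (.storeIdx ⟨o + a + 6, 10, 11⟩ 4) .skip)
    .skip

/-- Propagates all marks from one entry to another one that is incompatible with it. -/
def propagateAll (o : ℕ) : Cmd :=
  ifLt [(10, 11), (12, 13)] [(10, 13), (12, 11)]
    (.seq (propagate o 0 1 2) (.seq (propagate o 1 0 2) (propagate o 2 0 1))) .skip

/-- Propagates all marks between all pairs of entries. -/
def sweep (o : ℕ) : Cmd :=
  forLoop 10 2 (forLoop 11 3 (forLoop 12 2 (forLoop 13 3 (propagateAll o))))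

/-- The promised marks refer to the tables `t₁` at the start of the sweep, since `Marks` needs a set
independent of the current state; `Grow t₁ t` keeps those premises valid. -/
theorem marks_propagate {t₁ : Tab} (he : Env m n e) {i k : Fin m} {j l : Fin n}
    (hI : Incompat A i j k l) (e10 : e 10 = i) (e11 : e 11 = j) (e12 : e 12 = k) (e13 : e 13 = l)
    {a b d : Fin 3} (hab : a ≠ b) (had : a ≠ d) (hbd : b ≠ d) :
    Marks A' 14 e (propagate o a b d) 5 (fun t => Sound o (Excl A S) t₀ t ∧ Grow t₁ t)
      {p | (∀ b : Fin 3, b ≠ a → t₁ (o + b + 6) k l ≠ 0) ∧ p = (o + a, (i : ℕ), (j : ℕ))} := by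
  rintro t ⟨hs, hg⟩
  have hskip (x : Fin 3) (hx : x ≠ a) (h : t (o + x + 6) k l = 0) {T : ℕ} (hT : 1 ≤ T) :
      Run A' 14 e .skip T t fun t' => (Sound o (Excl A S) t₀ t' ∧ Grow t₁ t') ∧ Grow t t' ∧
        ∀ y z w, (y, z, w) ∈ {p : ℕ × ℕ × ℕ | (∀ b : Fin 3, b ≠ a → t₁ (o + b + 6) k l ≠ 0) ∧
          p = (o + a, (i : ℕ), (j : ℕ))} → t' (y + 6) z w ≠ 0 :=
    (Run.skip ⟨⟨hs, hg⟩, Grow.refl t, fun _ _ _ hp => absurd h (hg _ _ _ (hp.1 x hx))⟩).mono hT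
      fun _ h => h
  refine Run.ifBit (T := 3) (by omega) (by omega) (by omega) he.one (fun hb => ?_) (fun hb => ?_)
  · refine Run.ifBit (T := 1) (by omega) (by omega) (by omega) he.one (fun hd => ?_) (fun hd => ?_)
    · rw [e12, e13] at hb hd
      have hX : Excl A S a i j := .step hI fun x hx => by
        rcases fin3_cases hab hbd had x with rfl | rfl | rfl
        exacts [absurd rfl hx, hs.bits _ _ _ hb, hs.bits _ _ _ hd]
      refine Run.store (by omega) (by omega) (by omega) ?_
      rw [e10, e11, he.one]
      refine ⟨⟨hs.upd hX, hg.trans (Grow.upd _ _ _ one_ne_zero)⟩, Grow.upd _ _ _ one_ne_zero, ?_⟩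
      rintro y z w ⟨-, hp⟩
      obtain ⟨rfl, rfl, rfl⟩ : y = o + a ∧ z = i ∧ w = j := by simpa using hp
      rw [upd_self]
      exact one_ne_zero
    · exact hskip d had.symm (by rwa [e12, e13] at hd) le_rfl
  · exact hskip b hab.symm (by rwa [e12, e13] at hb) (by norm_num)

theorem marks_propagateAll {t₁ : Tab} (hA : ∀ (i : Fin m) (j : Fin n), A' i j = A i j)
    (he : Env m n e) {i k : Fin m} {j l : Fin n} (e10 : e 10 = i) (e11 : e 11 = j) (e12 : e 12 = k)
    (e13 : e 13 = l) :
    Marks A' 14 e (propagateAll o) 22 (fun t => Sound o (Excl A S) t₀ t ∧ Grow t₁ t)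
      {p | Incompat A i j k l ∧ ∃ a : Fin 3, (∀ b : Fin 3, b ≠ a → t₁ (o + b + 6) k l ≠ 0) ∧
        p = (o + a, (i : ℕ), (j : ℕ))} := by
  have hI : sumVal A' e [(10, 11), (12, 13)] < sumVal A' e [(10, 13), (12, 11)] ↔
      Incompat A i j k l := by
    simp [sumVal, e10, e11, e12, e13, hA, Incompat]
  refine Marks.ifLt (T := 15) (by simp) (by simp) (fun h => ?_) fun h =>
    Marks.skip.mono (by norm_num) fun p hp => absurd (hI.2 hp.1) (not_lt.2 h)
  have h := hI.1 h
  refine ((marks_propagate (a := 0) (b := 1) (d := 2) he h e10 e11 e12 e13 (by decide) (by decide)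
    (by decide)).seq ((marks_propagate (a := 1) (b := 0) (d := 2) he h e10 e11 e12 e13 (by decide)
    (by decide) (by decide)).seq (marks_propagate (a := 2) (b := 0) (d := 1) he h e10 e11 e12 e13
    (by decide) (by decide) (by decide)))).mono le_rfl ?_
  rintro p ⟨-, a, hb⟩
  have ha : a = 0 ∨ a = 1 ∨ a = 2 := fin3_cases (by decide) (by decide) (by decide) a
  rcases ha with rfl | rfl | rfl
  exacts [.inl hb, .inr (.inl hb), .inr (.inr hb)]

theorem run_sweep (hA : ∀ (i : Fin m) (j : Fin n), A' i j = A i j) (he : Env m n e) {t : Tab}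
    (ht : Sound o (Excl A S) t₀ t) :
    Run A' 10 e (sweep o) (5 * m * (5 * n * (5 * m * (5 * n * 22)))) t fun t' =>
      Sound o (Excl A S) t₀ t' ∧ Grow t t' ∧ ∀ (a : Fin 3) i j k l, Incompat A i j k l →
        (∀ b : Fin 3, b ≠ a → t (o + b + 6) k l ≠ 0) → t' (o + a + 6) i j ≠ 0 := by
  have hm : 1 ≤ m := by have := he.rows; omega
  have hn : 1 ≤ n := by have := he.cols; omega
  have pos {a b : ℕ} (ha : 1 ≤ a) (hb : 1 ≤ b) : 1 ≤ 5 * a * b := by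
    have := Nat.mul_pos (Nat.mul_pos (by norm_num : 0 < 5) ha) hb
    omega
  have p1 := pos hn (by norm_num : 1 ≤ 22)
  have p2 := pos hm p1
  have p3 := pos hn p2
  have key := Marks.forLoop (by omega) (by omega) he.one he.rows p3 fun i : Fin m =>
    have he := he.update (x := 10) (by omega) i
    Marks.forLoop (by omega) (by omega) he.one he.cols p2 fun j : Fin n =>
    have he := he.update (x := 11) (by omega) j
    Marks.forLoop (by omega) (by omega) he.one he.rows p1 fun k : Fin m =>
    have he := he.update (x := 12) (by omega) k
    Marks.forLoop (by omega) (by omega) he.one he.cols (by norm_num) fun l : Fin n =>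
    marks_propagateAll (o := o) (S := S) (t₀ := t₀) (t₁ := t) (i := i) (j := j) (k := k) (l := l) hA
      (he.update (x := 13) (by omega) l) (by simp) (by simp) (by simp) (by simp)
  refine (key t ⟨ht, Grow.refl t⟩).mono le_rfl ?_
  rintro t' ⟨⟨h1, h2⟩, -, h3⟩
  refine ⟨h1, h2, fun a i j k l hI hb => h3 (o + a) i j ?_⟩
  simp only [Set.mem_iUnion]
  exact ⟨i, j, k, l, hI, a, hb, rfl⟩

/-! ### Saturation -/

/-- All marks that the seeds entail are set. -/
def Full (o : ℕ) (X : Fin 3 → Fin m → Fin n → Prop) (t : Tab) : Prop :=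
  ∀ (a : Fin 3) i j, X a i j → t (o + a + 6) i j ≠ 0

/-- All marks of the seeds are set. -/
def Seeded (o : ℕ) (S : Fin 3 → Fin m → Fin n → Prop) (t : Tab) : Prop :=
  ∀ (a b : Fin 3) i j, S a i j → b ≠ a → t (o + b + 6) i j ≠ 0

/-- The marks that are set. -/
def marked (m n o : ℕ) (t : Tab) : Finset (Fin 3 × Fin m × Fin n) :=
  {p | t (o + p.1 + 6) p.2.1 p.2.2 ≠ 0}

/-- The marks are sound, and all of them or at least `N` are set. -/
structure Progress (A : Matrix (Fin m) (Fin n) ℝ) (o : ℕ) (S : Fin 3 → Fin m → Fin n → Prop)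
    (t₀ : Tab) (N : ℕ) (t : Tab) : Prop where
  sound : Sound o (Excl A S) t₀ t
  seeded : Seeded o S t
  card : Full o (Excl A S) t ∨ N ≤ (marked m n o t).card

theorem full_of_closed {t : Tab} (hs : Seeded o S t) (h : ∀ (a : Fin 3) i j k l,
    Incompat A i j k l → (∀ b : Fin 3, b ≠ a → t (o + b + 6) k l ≠ 0) → t (o + a + 6) i j ≠ 0) :
    Full o (Excl A S) t := by
  intro a i j hX
  induction hX with
  | seed hS hb => exact hs _ _ _ _ hS hb
  | step hI _ ih => exact h _ _ _ _ _ hI ih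

/-- A sweep that adds no mark shows that the marks were already closed under propagation, hence
full; otherwise their number grows. -/
theorem run_sweep_progress (hA : ∀ (i : Fin m) (j : Fin n), A' i j = A i j) (he : Env m n e)
    {t : Tab} {N : ℕ} (ht : Progress A o S t₀ N t) :
    Run A' 10 e (sweep o) (5 * m * (5 * n * (5 * m * (5 * n * 22)))) t
      (Progress A o S t₀ (N + 1)) := by
  refine (run_sweep hA he ht.sound).mono le_rfl ?_
  rintro t' ⟨h1, h2, h3⟩
  refine ⟨h1, fun a b i j hS hb => h2 _ _ _ (ht.seeded a b i j hS hb), ?_⟩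
  have hfull (h : Full o (Excl A S) t) : Full o (Excl A S) t' :=
    fun a i j hX => h2 _ _ _ (h a i j hX)
  rcases ht.card with h | h
  · exact .inl (hfull h)
  · have hsub : marked m n o t ⊆ marked m n o t' := by
      intro p hp
      simp only [marked, Finset.mem_filter_univ] at hp ⊢
      exact h2 _ _ _ hp
    rcases hsub.eq_or_ssubset with heq | hlt
    · refine .inl (hfull (full_of_closed ht.seeded fun a i j k l hI hb => ?_))
      have hmem : (a, i, j) ∈ marked m n o t' := by
        simp only [marked, Finset.mem_filter_univ]
        exact h3 a i j k l hI hb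
      rw [← heq] at hmem
      simpa only [marked, Finset.mem_filter_univ] using hmem
    · exact .inr (h.trans_lt (Finset.card_lt_card hlt))

/-- Propagates all marks until nothing changes any more. -/
def saturate (o : ℕ) : Cmd :=
  forLoop 8 2 (forLoop 9 3 (.seq (.seq (sweep o) (sweep o)) (.seq (sweep o) (sweep o))))

theorem run_saturate (hA : ∀ (i : Fin m) (j : Fin n), A' i j = A i j) (he : Env m n e) {t : Tab}
    (ht : Sound o (Excl A S) t₀ t) (hS : Seeded o S t) :
    Run A' 8 e (saturate o)
      (5 * m * (5 * n * (4 * (5 * m * (5 * n * (5 * m * (5 * n * 22))))))) t fun t' =>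
      Sound o (Excl A S) t₀ t' ∧ Full o (Excl A S) t' := by
  have hm : 0 < m := by have := he.rows; omega
  have hn : 0 < n := by have := he.cols; omega
  refine (Run.forLoop (fun k => Progress A o S t₀ (k * (n * 4))) (by omega) (by omega) he.one he.rows
    (Nat.succ_le_of_lt (by positivity)) (fun i t ht => ?_) ⟨ht, hS, .inr (by simp)⟩).mono le_rfl ?_
  · have he := he.update (x := 8) (by omega) i
    refine (Run.forLoop (fun k => Progress A o S t₀ (i * (n * 4) + k * 4)) (by omega) (by omega)
      he.one he.cols (Nat.succ_le_of_lt (by positivity)) (fun j t ht => ?_) (by simpa using ht)).mono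
      le_rfl fun t' ht' => ?_
    · have he := he.update (x := 9) (by omega) j
      refine (((run_sweep_progress hA he ht).seq fun t ht => run_sweep_progress hA he ht).seq
        fun t ht => (run_sweep_progress hA he ht).seq fun t ht =>
          run_sweep_progress hA he ht).mono (by omega) fun t' ht' => ?_
      convert ht' using 1
      ring
    · convert ht' using 1
      ring
  · rintro t' ⟨h1, -, h2 | h2⟩
    · exact ⟨h1, h2⟩
    -- After `4mn` sweeps the count would be at least `4mn`, but there are only `3mn` possible
    -- marks.
    · have h3 := h2.trans (Finset.card_le_univ _)
      simp only [Fintype.card_prod, Fintype.card_fin] at h3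
      have := Nat.mul_pos hm hn
      nlinarith

/-! ### Conflicts -/

/-- Sets the mark of table `o + 13` if some entry has three marks. -/
def detect (o : ℕ) : Cmd :=
  forLoop 8 2 (forLoop 9 3 (ifBit 10 (o + 6) 8 9 (ifBit 10 (o + 1 + 6) 8 9 (ifBit 10 (o + 2 + 6) 8 9
    (.storeIdx ⟨o + 7 + 6, 5, 5⟩ 4) .skip) .skip) .skip))

theorem run_detect (he : Env m n e) {t : Tab} (ht : Sound o X t₀ t) (hf : Full o X t) :
    Run A' 8 e (detect o) (5 * m * (5 * n * 7)) t fun t' =>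
      Sound o X t₀ t' ∧ ((∃ i j, ∀ a, X a i j) → t' (o + 7 + 6) 0 0 ≠ 0) := by
  have hn : 0 < n := by have := he.cols; omega
  have key := Marks.forLoop (A := A') (I := fun t => Sound o X t₀ t ∧ Full o X t) (by omega)
    (by omega) he.one he.rows (Nat.succ_le_of_lt (by positivity)) fun i : Fin m =>
    have he := he.update (x := 8) (by omega) i
    Marks.forLoop (T := 7) (P := ifBit 10 (o + 6) 8 9 (ifBit 10 (o + 1 + 6) 8 9
      (ifBit 10 (o + 2 + 6) 8 9 (.storeIdx ⟨o + 7 + 6, 5, 5⟩ 4) .skip) .skip) .skip)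
    (C := fun j => {p | p = (o + 7, 0, 0) ∧ ∀ a, X a i j}) (by omega) (by omega) he.one he.cols
    (by norm_num) fun j : Fin n => by
      have he := he.update (x := 9) (by omega) j
      rintro t ⟨hs, hf⟩
      have hskip (x : Fin 3) (h : t (o + x + 6) i j = 0) {T : ℕ} (hT : 1 ≤ T) :
          Run A' 10 (Function.update (Function.update e 8 i) 9 j) .skip T t fun t' =>
            (Sound o X t₀ t' ∧ Full o X t') ∧ Grow t t' ∧
              ∀ y z w, (y, z, w) ∈ {p : ℕ × ℕ × ℕ | p = (o + 7, 0, 0) ∧ ∀ a, X a i j} →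
                t' (y + 6) z w ≠ 0 :=
        (Run.skip ⟨⟨hs, hf⟩, Grow.refl t, fun _ _ _ hp => absurd h (hf x i j (hp.2 x))⟩).mono hT
          fun _ h => h
      refine Run.ifBit (T := 5) (by omega) (by omega) (by omega) he.one (fun h0 => ?_)
        (fun h0 => hskip 0 (by simpa using h0) (by norm_num))
      refine Run.ifBit (T := 3) (by omega) (by omega) (by omega) he.one (fun h1 => ?_)
        (fun h1 => hskip 1 (by simpa using h1) (by norm_num))
      refine Run.ifBit (T := 1) (by omega) (by omega) (by omega) he.one (fun h2 => ?_)
        (fun h2 => hskip 2 (by simpa using h2) (by norm_num))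
      refine Run.store (by omega) (by omega) (by omega) ?_
      have hX : ∀ a, X a i j := by
        intro a
        refine hs.bits a i j ?_
        fin_cases a
        exacts [by simpa using h0, by simpa using h1, by simpa using h2]
      rw [he.one, he.zero]
      refine ⟨⟨hs.upd_flag ⟨i, j, hX⟩, fun a k l hk => upd_ne_zero one_ne_zero (hf a k l hk)⟩,
        Grow.upd _ _ _ one_ne_zero, ?_⟩
      rintro y z w ⟨hp, -⟩
      obtain ⟨rfl, rfl, rfl⟩ : y = o + 7 ∧ z = 0 ∧ w = 0 := by simpa using hp
      rw [upd_self]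
      exact one_ne_zero
  refine (key t ⟨ht, hf⟩).mono le_rfl ?_
  rintro t' ⟨⟨h1, -⟩, -, h3⟩
  refine ⟨h1, fun ⟨i, j, hX⟩ => h3 (o + 7) 0 0 ?_⟩
  simp only [Set.mem_iUnion]
  exact ⟨i, j, rfl, hX⟩

/-- Finds out whether the guess `g` leads to a conflict. -/
def refute (o : ℕ) (g : Bool) : Cmd := .seq (seeds o g) (.seq (saturate o) (detect o))

/-- The first clause lets the second guess start from the same triangle and from empty tables of its
own, and keeps the verdict of the first. -/
theorem run_refute (hA : ∀ (i : Fin m) (j : Fin n), A' i j = A i j) (he : Env m n e) {t : Tab}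
    {r : Fin 3 → Fin m} {c : Fin 3 → Fin n} (ht : Holds t r c) (g : Bool)
    (h0 : ∀ a, a < 3 → t (o + a + 6) = fun _ _ => 0) (h13 : t (o + 7 + 6) = fun _ _ => 0) :
    Run A' 8 e (refute o g)
      (27 + (5 * m * (5 * n * (4 * (5 * m * (5 * n * (5 * m * (5 * n * 22)))))) +
        5 * m * (5 * n * 7))) t fun t' =>
      (∀ a, a < o + 6 ∨ o + 8 < a ∧ a ≠ o + 13 → t' a = t a) ∧
        (t' (o + 7 + 6) 0 0 ≠ 0 ↔ ∃ i j, ∀ a, Excl A (Seed A r c g) a i j) := by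
  have hs : Sound o (Excl A (Seed A r c g)) t t := by
    refine ⟨fun _ _ => rfl, fun a i j h => absurd ?_ h, fun h => absurd ?_ h⟩
    · rw [h0 a a.2]
    · rw [h13]
  refine (marks_seeds hA he ht g (fun a b i j hS hb => .seed hS hb) t hs).seq ?_
  rintro t₁ ⟨h1, -, h2⟩
  refine (run_saturate (S := Seed A r c g) hA he h1 fun a b i j hS hb =>
    h2 _ _ _ ⟨a, b, i, j, hS, hb, rfl⟩).seq ?_
  rintro t₂ ⟨h3, h4⟩
  refine (run_detect he h3 h4).mono le_rfl ?_
  rintro t₃ ⟨h5, h6⟩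
  exact ⟨h5.frame, h5.flag, h6⟩

end

end RealRAM

/-! ### The complete program and its running time -/

namespace RealRAM

open TropRank

/-- Stores whether both guesses lead to a conflict. -/
def verdict : Cmd :=
  ifBit 8 13 5 5 (ifBit 8 16 5 5 (.storeIdx ⟨17, 5, 5⟩ 4) .skip) .skip

/-- Decides whether the factor rank is greater than `3`, given that the registers `2` to `5` are
set. -/
def decideRank : Cmd :=
  .seq search (ifBit 8 12 5 5 (.seq (refute 0 true) (.seq (refute 3 false) verdict)) .skip)

/-- Sets the registers `2` to `5`, and returns in register `0` whether the factor rank is greater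
than `3`. -/
def rankProgram : Cmd :=
  .seq (.idxConst 4 1) (.seq (.idxConst 5 0) (.seq (.idxOp .sub 2 0 4) (.seq (.idxOp .sub 3 1 4)
    (.seq decideRank (.loadIdx 0 ⟨17, 5, 5⟩)))))

section

variable {m n : ℕ} {A : Matrix (Fin m) (Fin n) ℝ} {A' : ℕ → ℕ → ℝ} {e : ℕ → ℕ}

theorem three_lt_factorRank_iff (A : Matrix (Fin m) (Fin n) ℝ) {r : Fin 3 → Fin m}
    {c : Fin 3 → Fin n} (h : Tri A r c) : 3 < factorRank A ↔
      (∃ i j, ∀ a, Excl A (Seed A r c true) a i j) ∧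
        ∃ i j, ∀ a, Excl A (Seed A r c false) a i j := by
  rw [← not_le, factorRank_le_three_iff, h.colorable_iff]
  simp [and_comm]

theorem factorRank_le_three_of_no_tri (h : ∀ r c, ¬ Tri A r c) : factorRank A ≤ 3 :=
  (factorRank_le_three_iff A).2 (colorable_of_no_tri h)

theorem run_decideRank (hA : ∀ (i : Fin m) (j : Fin n), A' i j = A i j) (he : Env m n e) :
    Run A' 8 e decideRank (10000000 * (m ^ 3 * n ^ 3)) (fun _ _ _ => 0) fun t =>
      t 17 0 0 = if 3 < factorRank A then 1 else 0 := by
  have hm : 0 < m := by have := he.rows; omega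
  have hn : 0 < n := by have := he.cols; omega
  have htime : 5 * m * (5 * m * (5 * m * (5 * n * (5 * n * (5 * n * 46))))) +
      (27 + (5 * m * (5 * n * (4 * (5 * m * (5 * n * (5 * m * (5 * n * 22)))))) +
        5 * m * (5 * n * 7)) + (27 + (5 * m * (5 * n * (4 * (5 * m * (5 * n * (5 * m *
          (5 * n * 22)))))) + 5 * m * (5 * n * 7)) + 5) + 2) ≤ 10000000 * (m ^ 3 * n ^ 3) := by
    have h1 : 1 ≤ m * n := Nat.mul_pos hm hn
    have h2 : m * n ≤ (m * n) ^ 3 := Nat.le_self_pow (by norm_num) _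
    have h3 : (m * n) ^ 3 = m ^ 3 * n ^ 3 := by ring
    have h4 : 5 * m * (5 * m * (5 * m * (5 * n * (5 * n * (5 * n * 46))))) =
      718750 * (m ^ 3 * n ^ 3) := by ring
    have h5 : 5 * m * (5 * n * (4 * (5 * m * (5 * n * (5 * m * (5 * n * 22)))))) =
      1375000 * (m ^ 3 * n ^ 3) := by ring
    have h6 : 5 * m * (5 * n * 7) = 175 * (m * n) := by ring
    rw [h4, h5, h6]
    omega
  refine Run.mono (Run.seq (run_search hA he ⟨fun _ _ _ => rfl, fun h => absurd rfl h⟩) ?_) htime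
    fun _ h => h
  rintro t ⟨ht, hno⟩
  have h17 : t 17 0 0 = 0 := by rw [ht.clear 17 (by norm_num) (by norm_num)]
  refine Run.ifBit (by norm_num) (by norm_num) (by norm_num) he.one (fun h => ?_) (fun h => ?_)
  · rw [he.zero] at h
    obtain ⟨r, c, hT, hH⟩ := ht.found h
    refine (run_refute (o := 0) hA he hH true (fun a ha => ht.clear _ (by omega) (by omega))
      (ht.clear _ (by omega) (by omega))).seq ?_
    rintro t₁ ⟨hf₁, hc₁⟩
    have hH₁ : Holds t₁ r c := by
      unfold Holds
      rwa [hf₁ 0 (by omega), hf₁ 1 (by omega), hf₁ 2 (by omega), hf₁ 3 (by omega),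
        hf₁ 4 (by omega), hf₁ 5 (by omega)]
    refine (run_refute (o := 3) hA he hH₁ false (fun a ha => ?_) ?_).seq ?_
    · rw [hf₁ _ (by omega), ht.clear _ (by omega) (by omega)]
    · rw [hf₁ _ (by omega), ht.clear _ (by omega) (by omega)]
    rintro t₂ ⟨hf₂, hc₂⟩
    have hz : t₂ 17 0 0 = 0 := by
      rw [hf₂ 17 (by omega), hf₁ 17 (by omega), h17]
    rw [← hf₂ _ (by omega)] at hc₁
    have hiff := three_lt_factorRank_iff A hT
    rw [← hc₁, ← hc₂] at hiff
    refine Run.ifBit (T := 3) (by norm_num) (by norm_num) (by norm_num) he.one (fun h1 => ?_)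
      (fun h1 => (Run.skip ?_).mono (by norm_num) fun _ h => h)
    · refine Run.ifBit (T := 1) (by norm_num) (by norm_num) (by norm_num) he.one (fun h2 => ?_)
        (fun h2 => Run.skip ?_)
      · rw [he.zero] at h1 h2
        refine Run.store (by norm_num) (by norm_num) (by norm_num) ?_
        rw [he.zero, he.one, upd_self, if_pos (hiff.2 ⟨h1, h2⟩)]
      · rw [he.zero] at h2
        rw [hz, if_neg fun h => (hiff.1 h).2 h2]
    · rw [he.zero] at h1
      rw [hz, if_neg fun h => (hiff.1 h).1 h1]
  · rw [he.zero] at h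
    refine (Run.skip ?_).mono (by omega) fun _ h => h
    rw [h17, if_neg (not_lt.2 (factorRank_le_three_of_no_tri (hno h)))]

theorem exec_rankProgram (hm : 0 < m) (hn : 0 < n) (A : Matrix (Fin m) (Fin n) ℝ) :
    ∃ (t : ℕ) (s : State), Exec rankProgram (input A) t s ∧
      s.idx 0 = (if 3 < factorRank A then 1 else 0) ∧ t ≤ 10000005 * (m ^ 3 * n ^ 3) := by
  let s₀ := ((((input A).setIdx 4 1).setIdx 5 0).setIdx 2 (m - 1)).setIdx 3 (n - 1)
  have he : Env m n s₀.idx := by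
    constructor <;> simp [s₀, State.setIdx] <;> omega
  obtain ⟨t, s, hE, ht, h1, -, h2⟩ := run_decideRank (A := A) (A' := (input A).mem 0)
    (fun i j => by simp [input]) he s₀ (fun _ _ => rfl) rfl rfl
  refine ⟨_, _, .seq (.idxConst _ _ _) (.seq (.idxConst _ _ _) (.seq (.idxOp _ _ _ _ _)
    (.seq (.idxOp _ _ _ _ _) (.seq (s' := s) (t := t) ?_ (.loadIdx _ _ _))))), ?_, ?_⟩
  · convert hE using 1
    simp [s₀, State.setIdx, IdxOp.eval, input]
  · have h5 : s.idx 5 = 0 := by rw [h1 5 (by norm_num), he.zero]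
    simpa [State.setIdx, State.getTab, h5] using h2
  -- The five additional steps are four initial instructions and the final load.
  · have : 1 ≤ m ^ 3 * n ^ 3 := Nat.mul_pos (pow_pos hm 3) (pow_pos hn 3)
    omega

end

end RealRAM

/-- One program decides, for every real matrix `A` of every size `m × n`, whether the factor rank
of `A` exceeds `3` (index register `0` finally holds `1` if it does and `0` if not), within
`O((m + n)³ m n log (m n) + m³ n³)` steps. -/
theorem mainTheorem5 :
    ∃ (P : RealRAM.Cmd) (K : ℝ), ∀ (m n : ℕ), 0 < m → 0 < n →
      ∀ A : Matrix (Fin m) (Fin n) ℝ, ∃ (t : ℕ) (s : RealRAM.State),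
        RealRAM.Exec P (RealRAM.input A) t s ∧
        s.idx 0 = (if 3 < factorRank A then 1 else 0) ∧
        (t : ℝ) ≤ K * (((m : ℝ) + n) ^ 3 * (m * n) * Real.log ((m : ℝ) * n)
          + (m : ℝ) ^ 3 * (n : ℝ) ^ 3) := by
  refine ⟨RealRAM.rankProgram, 10000005, fun m n hm hn A => ?_⟩
  obtain ⟨t, s, hE, hs, ht⟩ := RealRAM.exec_rankProgram hm hn A
  refine ⟨t, s, hE, hs, ?_⟩
  have hmn : (1 : ℝ) ≤ m * n := by exact_mod_cast Nat.mul_pos hm hn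
  have hlog := Real.log_nonneg hmn
  have h1 : (t : ℝ) ≤ 10000005 * ((m : ℝ) ^ 3 * (n : ℝ) ^ 3) := by exact_mod_cast ht
  -- The term `m³n³` alone already bounds the running time; the logarithmic term only has to be
  -- nonnegative.
  have h2 : 0 ≤ ((m : ℝ) + n) ^ 3 * (m * n) * Real.log ((m : ℝ) * n) := by positivity
  linarith
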